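/- Let $n\ge 5$, with indices understood modulo $n$. Let $\mathcal S^n$ be the space of real symmetric $n\times n$ matrices and $\mathcal C^n\subset\mathcal S^n$ the cone of copositive matrices (those $A$ with $x^TAx\ge 0$ for all $x\in\mathbb R^n_+$). A matrix $A\in\mathcal C^n$ is exceptional if it is not the sum of a positive semi-definite and an entrywise nonnegative symmetric matrix, and extremal if it generates an extreme ray of $\mathcal C^n$. A zero of $A\in\mathcal C^n$ is a vector $u\in\mathbb R^n_+\setminus\{0\}$ with $u^TAu=0$; its support is the index set of its positive entries. For $j=1,\dots,n$ put $I_j=(j,j+1,\dots,j+n-3)$ and $I'_j=(j,j+1,\dots,j+n-4)$. For ordered index sets $I,J$ write $X_{I,J}=(X_{ik})_{i\in I,\,k\in J}$ and $X_I=X_{I,I}$. An exceptional $A\in\mathcal C^n$ has non-minimal circulant zero support set if it has zeros $u^1,\dots,u^n$ with supports $I_1,\dots,I_n$, respectively, and some zero that is not proportional to any of $u^1,\dots,u^n$. Let $\hat A\in\mathcal C^n$ be an exceptional matrix with non-minimal circulant zero support set. Then there is an open neighbourhood $\mathcal U\subset\mathcal S^n$ of $\hat A$ such that: (i) if $A\in\mathcal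 U$ and $\operatorname{rk}A_{I_j}=n-4$ for all $j=1,\dots,n$, then $A$ is an exceptional extremal copositive matrix with non-minimal circulant zero support set; (ii) the set $\mathcal M=\{A\in\mathcal U : \operatorname{rk}A_{I_j}=n-4,\ j=1,\dots,n\}$ contains $\hat A$ and is an algebraic submanifold of codimension $2n$ in $\mathcal S^n$, i.e. an embedded smooth submanifold that is cut out from $\mathcal U$ by finitely many polynomial equations. More precisely, $\mathcal M$ is the set of all $X\in\mathcal U$ which satisfy the $2n$ equations $\det X_{I'_j}=0$ and $\det X_{I'_j,I'_{j+1}}=0$, $j=1,\dots,n$, and the gradients on $\mathcal S^n$ of these $2n$ determinants are linearly independent at every point of $\mathcal M$. -/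

import Mathlib

open scoped Matrix ContDiff

-- The (finite-dimensional) topology and smooth structure of matrix spaces; the choice of the
-- norm is immaterial for everything below.
attribute [local instance] Matrix.normedAddCommGroup Matrix.normedSpace

/-- The real vector space `𝒮ⁿ` of symmetric `n × n` matrices. -/
def symMatSubmodule (n : ℕ) : Submodule ℝ (Matrix (Fin n) (Fin n) ℝ) where
  carrier := {A | A.IsSymm}
  add_mem' := fun ha hb => ha.add hb
  zero_mem' := Matrix.isSymm_zero
  smul_mem' := fun c _ ha => ha.smul c

abbrev SymMat (n : ℕ) : Type := symMatSubmodule n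

/-- Membership in the copositive cone `𝒞ⁿ`. -/
def IsCopositive {n : ℕ} (A : SymMat n) : Prop :=
  ∀ x : Fin n → ℝ, 0 ≤ x → 0 ≤ x ⬝ᵥ (A.1 *ᵥ x)

/-- A copositive matrix is exceptional if it is not the sum of a positive semi-definite matrix
and an element-wise nonnegative symmetric matrix. -/
def IsExceptional {n : ℕ} (A : SymMat n) : Prop :=
  IsCopositive A ∧
    ¬ ∃ P N : SymMat n, P.1.PosSemidef ∧ (∀ i j, 0 ≤ N.1 i j) ∧ A = P + N

/-- `A` is extremal if it generates an extreme ray of the copositive cone. -/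
def IsExtremal {n : ℕ} (A : SymMat n) : Prop :=
  A ≠ 0 ∧ IsCopositive A ∧
    ∀ B C : SymMat n, IsCopositive B → IsCopositive C → A = B + C →
      ∃ b c : ℝ, 0 ≤ b ∧ 0 ≤ c ∧ B = b • A ∧ C = c • A

/-- `u` is a zero of `A`: a nonzero nonnegative vector with `uᵀ A u = 0`. -/
def IsCopZero {n : ℕ} (A : SymMat n) (u : Fin n → ℝ) : Prop :=
  u ≠ 0 ∧ 0 ≤ u ∧ u ⬝ᵥ (A.1 *ᵥ u) = 0

/-- The index `j + k`, taken cyclically modulo `n`. -/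
def cyc {n : ℕ} (j : Fin n) (k : ℕ) : Fin n :=
  ⟨(j.1 + k) % n, Nat.mod_lt _ j.pos⟩

/-- The ordered index set `I_j = (j, j+1, …, j+n-3)` of cardinality `n - 2`. -/
def idxI {n : ℕ} (j : Fin n) : Fin (n - 2) → Fin n := fun k => cyc j k

/-- The ordered index set `I'_j = (j, j+1, …, j+n-4)` of cardinality `n - 3`. -/
def idxI' {n : ℕ} (j : Fin n) : Fin (n - 3) → Fin n := fun k => cyc j k

/-- `A` is an exceptional copositive matrix which has zeros `u¹, …, uⁿ` with supports
`I_1, …, I_n` and, in addition, some zero which is not proportional to any of these. -/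
def HasNonMinimalCirculantZeroSupport {n : ℕ} (A : SymMat n) : Prop :=
  IsExceptional A ∧
    ∃ u : Fin n → Fin n → ℝ,
      (∀ j, IsCopZero A (u j) ∧ {i | 0 < u j i} = Set.range (idxI j)) ∧
      ∃ v : Fin n → ℝ, IsCopZero A v ∧ ∀ j, ¬ ∃ c : ℝ, v = c • u j

/-- `M` is an (embedded) smooth submanifold of codimension `k` of the finite-dimensional space `E`:
around each of its points some smooth chart of `E` flattens `M` to a linear subspace of
codimension `k`. -/
def IsSmoothSubmanifoldOfCodim {E : Type*} [NormedAddCommGroup E] [NormedSpace ℝ E]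
    [FiniteDimensional ℝ E] (M : Set E) (k : ℕ) : Prop :=
  ∀ x ∈ M, ∃ (φ : OpenPartialHomeomorph E E) (F : Submodule ℝ E),
    x ∈ φ.source ∧ ContDiffOn ℝ ∞ φ φ.source ∧ ContDiffOn ℝ ∞ φ.symm φ.target ∧
    Module.finrank ℝ (E ⧸ F) = k ∧ ∀ y ∈ φ.source, y ∈ M ↔ φ y ∈ F

/-- Within the set `U` (an open one in all uses), `M` is an algebraic submanifold of codimension
`k`: a smooth submanifold which is cut out from `U` by finitely many polynomial equations in the
matrix entries. -/
def IsAlgebraicSubmanifoldOfCodim {n : ℕ} (U M : Set (SymMat n)) (k : ℕ) : Prop :=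
  IsSmoothSubmanifoldOfCodim M k ∧
    ∃ (m : ℕ) (p : Fin m → MvPolynomial (Fin n × Fin n) ℝ),
      M = {X | X ∈ U ∧ ∀ i, MvPolynomial.eval (fun ab => X.1 ab.1 ab.2) (p i) = 0}

/-- All the submatrices `A_{I_j}` have rank `n - 4`. -/
def CirculantRankCondition {n : ℕ} (A : SymMat n) : Prop :=
  ∀ j : Fin n, (A.1.submatrix (idxI j) (idxI j)).rank = n - 4

/-- The `2n` functions `X ↦ det X_{I'_j}` and `X ↦ det (X_{ik})_{i ∈ I'_j, k ∈ I'_{j+1}}`. -/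
def detFun {n : ℕ} : Fin n ⊕ Fin n → SymMat n → ℝ
  | Sum.inl j => fun X => (X.1.submatrix (idxI' j) (idxI' j)).det
  | Sum.inr j => fun X => (X.1.submatrix (idxI' j) (idxI' (cyc j 1))).det

/-! Everything is encoded in `n` vectors `w r`, nonnegative with support the complement of `{r, r+1,
r+2}`, such that `A (w r)` is a positive multiple of the unit vector `e_{r+1}`
(`MinimalCirculantZeros`), together with the nonsingularity of the principal blocks on the
complements of `{r, …, r+3}` (`NonsingularBlocks`).

For the given matrix, the zeros `u r` force `xᵀAx ≥ 2 θ_r x_r x_{r+2}` on the hyperplane `x_{r+1} =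
0`. Exceptionality forces `θ_r > 0` (`theta_pos`), since otherwise `A` would be positive
semi-definite. The first-order conditions of this inequality show that the vanishing set of any zero
consists of two or three consecutive indices (`exists_zero_pattern`). A zero not proportional to any
`u r` then produces a zero with three vanishing entries, and by rotation all the `w r`
(`exists_minimalCirculantZeros`).

Conversely, for a copositive matrix the `w r` give exceptionality and the required zeros; with
nonsingular blocks they also give extremality and the rank condition.

Near the given matrix, `w r` is continued as the solution of a linear system. The vanishing of the
`2n` determinants supplies the equations missing from that system, and positivity is an open
condition. Copositivity persists because the form is positive on a compact set of vectors with small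
support (`eventually_pos_on_smallSupportSimplex`), to which all others are reduced by subtracting
multiples of the `w r`.

The differentials of the determinants are nonzero multiples of `H ↦ (w r)ᵀ H (w r)` and `H ↦ (w r)ᵀ
H (w (r+1))`. As the `w r` form a basis, these are independent, and the level set of the resulting
submersion is a submanifold of codimension `2n`. -/

/-! ### Cyclic indices -/

theorem cyc_cyc {n : ℕ} (j : Fin n) (a b : ℕ) : cyc (cyc j a) b = cyc j (a + b) := by
  apply Fin.ext
  simp [cyc, Nat.add_assoc]

theorem cyc_eq_iff {n : ℕ} {j : Fin n} {a b : ℕ} (ha : a < n) (hb : b < n) :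
    cyc j a = cyc j b ↔ a = b := by
  refine ⟨fun h => ?_, fun h => h ▸ rfl⟩
  have h1 : (j.1 + a) ≡ (j.1 + b) [MOD n] := congrArg Fin.val h
  exact Nat.ModEq.eq_of_lt_of_lt (Nat.ModEq.add_left_cancel' _ h1) ha hb

theorem cyc_zero {n : ℕ} (j : Fin n) : cyc j 0 = j :=
  Fin.ext (by simp [cyc, Nat.mod_eq_of_lt j.2])

theorem cyc_eq_self_iff {n : ℕ} {j : Fin n} {a : ℕ} (ha : a < n) : cyc j a = j ↔ a = 0 := by
  conv_lhs => rw [← cyc_zero j, cyc_cyc]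
  rw [cyc_eq_iff (by omega) (by omega)]
  omega

theorem self_eq_cyc_iff {n : ℕ} {j : Fin n} {a : ℕ} (ha : a < n) : j = cyc j a ↔ a = 0 := by
  rw [eq_comm, cyc_eq_self_iff ha]

theorem cyc_add_period {n : ℕ} (j : Fin n) (a : ℕ) : cyc j (a + n) = cyc j a :=
  Fin.ext (by simp [cyc, ← Nat.add_assoc])

theorem exists_eq_cyc {n : ℕ} (j i : Fin n) : ∃ k < n, i = cyc j k := by
  have hi := i.2
  have hj := j.2
  by_cases h : j.1 ≤ i.1
  · exact ⟨i - j, by omega, Fin.ext (by simp [cyc, Nat.add_sub_cancel' h, Nat.mod_eq_of_lt hi])⟩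
  · refine ⟨i + n - j, by omega, Fin.ext ?_⟩
    have : j.1 + (i.1 + n - j.1) = i.1 + n := by omega
    simp [cyc, this, Nat.mod_eq_of_lt hi]

theorem cyc_induction {n : ℕ} {P : Fin n → Prop} (r : Fin n) (h0 : P r)
    (h1 : ∀ s, P s → P (cyc s 1)) (s : Fin n) : P s := by
  obtain ⟨k, -, rfl⟩ := exists_eq_cyc r s
  induction k with
  | zero => rwa [cyc_zero]
  | succ k ih => rw [← cyc_cyc]; exact h1 _ ih

/-! ### The bilinear form of a symmetric matrix -/

/-- The symmetric bilinear form `(x, y) ↦ xᵀ A y`. -/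
def bil {n : ℕ} (A : SymMat n) (x y : Fin n → ℝ) : ℝ := x ⬝ᵥ (A.1 *ᵥ y)

section bil

variable {n : ℕ} (A : SymMat n) (x y z : Fin n → ℝ) (c : ℝ)

theorem bil_eq_sum : bil A x y = ∑ i, x i * (A.1 *ᵥ y) i := rfl

theorem bil_comm : bil A x y = bil A y x := by
  unfold bil
  rw [Matrix.dotProduct_mulVec, ← Matrix.mulVec_transpose, A.2.eq, dotProduct_comm]

theorem bil_add_left : bil A (x + y) z = bil A x z + bil A y z := add_dotProduct _ _ _

theorem bil_add_right : bil A x (y + z) = bil A x y + bil A x z := by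
  simp [bil, Matrix.mulVec_add]

theorem bil_sub_left : bil A (x - y) z = bil A x z - bil A y z := sub_dotProduct _ _ _

theorem bil_sub_right : bil A x (y - z) = bil A x y - bil A x z := by
  simp [bil, Matrix.mulVec_sub]

theorem bil_smul_left : bil A (c • x) y = c * bil A x y := smul_dotProduct _ _ _

theorem bil_smul_right : bil A x (c • y) = c * bil A x y := by
  simp [bil, Matrix.mulVec_smul]

theorem bil_add_matrix (B : SymMat n) : bil (A + B) x y = bil A x y + bil B x y := by
  simp [bil, Matrix.add_mulVec]

theorem bil_single_left (i : Fin n) : bil A (Pi.single i 1) y = (A.1 *ᵥ y) i := by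
  simp [bil]

theorem bil_single_single (i k : Fin n) : bil A (Pi.single i 1) (Pi.single k 1) = A.1 i k := by
  simp [bil]

theorem bil_add_self : bil A (x + y) (x + y) = bil A x x + 2 * bil A x y + bil A y y := by
  rw [bil_add_left, bil_add_right, bil_add_right, bil_comm A y x]; ring

theorem bil_sub_self : bil A (x - y) (x - y) = bil A x x - 2 * bil A x y + bil A y y := by
  rw [bil_sub_left, bil_sub_right, bil_sub_right, bil_comm A y x]; ring

theorem bil_add_smul_self :
    bil A (x + c • y) (x + c • y) = bil A x x + 2 * c * bil A x y + c ^ 2 * bil A y y := by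
  rw [bil_add_self, bil_smul_right, bil_smul_right, bil_smul_left]; ring

theorem bil_sub_smul_self :
    bil A (x - c • y) (x - c • y) = bil A x x - 2 * c * bil A x y + c ^ 2 * bil A y y := by
  rw [bil_sub_self, bil_smul_right, bil_smul_right, bil_smul_left]; ring

end bil

theorem linear_coeff_eq_zero_of_nonneg {b c : ℝ} (h : ∀ t : ℝ, 0 ≤ 2 * t * b + t ^ 2 * c) :
    b = 0 := by
  by_contra hb
  have hc : 0 < |c| + 1 := by positivity
  have h1 := h (-(b / (|c| + 1)))
  have h2 : 2 * -(b / (|c| + 1)) * b + (-(b / (|c| + 1))) ^ 2 * c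
      = (b ^ 2 / (|c| + 1) ^ 2) * (c - 2 * (|c| + 1)) := by
    field_simp; ring
  rw [h2] at h1
  have h3 : 0 < b ^ 2 / (|c| + 1) ^ 2 := by positivity
  have h4 : c - 2 * (|c| + 1) < 0 := by have := le_abs_self c; have := abs_nonneg c; linarith
  nlinarith

theorem bil_eq_zero_of_nonneg {n : ℕ} (A : SymMat n) {x y : Fin n → ℝ}
    (h : ∀ t : ℝ, 0 ≤ bil A (x + t • y) (x + t • y)) (h0 : bil A x x = 0) : bil A x y = 0 := by
  apply linear_coeff_eq_zero_of_nonneg (c := bil A y y)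
  intro t
  have := h t
  rw [bil_add_smul_self, h0] at this
  linarith

theorem exists_min_ratio {n : ℕ} {x w : Fin n → ℝ} (hx : 0 ≤ x) (hw : 0 ≤ w) (hw0 : w ≠ 0)
    (h : ∀ i, 0 < w i → 0 < x i) :
    ∃ c : ℝ, 0 < c ∧ 0 ≤ x - c • w ∧ ∃ i, 0 < w i ∧ (x - c • w) i = 0 := by
  classical
  obtain ⟨k, hk⟩ := Function.ne_iff.1 hw0
  have hk' : 0 < w k := lt_of_le_of_ne (hw k) (Ne.symm hk)
  obtain ⟨i, hi, hmin⟩ := Finset.exists_min_image (Finset.univ.filter fun i => 0 < w i)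
    (fun i => x i / w i) ⟨k, by simpa using hk'⟩
  simp only [Finset.mem_filter, Finset.mem_univ, true_and] at hi hmin
  refine ⟨x i / w i, div_pos (h i hi) hi, fun l => ?_, i, hi, ?_⟩
  · simp only [Pi.zero_apply, Pi.sub_apply, Pi.smul_apply, smul_eq_mul, sub_nonneg]
    rcases (hw l).lt_or_eq with hl | hl
    · exact (le_div_iff₀ hl).1 (hmin l hl)
    · rw [← hl]; simpa using hx l
  · simp [div_mul_cancel₀ _ hi.ne']

theorem exists_max_ratio {n : ℕ} {x w : Fin n → ℝ} (hw : 0 ≤ w) (hw0 : w ≠ 0)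
    (h : ∀ i, w i = 0 → x i = 0) :
    ∃ c : ℝ, 0 ≤ c • w - x ∧ ∃ i, 0 < w i ∧ (c • w - x) i = 0 := by
  classical
  obtain ⟨k, hk⟩ := Function.ne_iff.1 hw0
  have hk' : 0 < w k := lt_of_le_of_ne (hw k) (Ne.symm hk)
  obtain ⟨i, hi, hmax⟩ := Finset.exists_max_image (Finset.univ.filter fun i => 0 < w i)
    (fun i => x i / w i) ⟨k, by simpa using hk'⟩
  simp only [Finset.mem_filter, Finset.mem_univ, true_and] at hi hmax
  refine ⟨x i / w i, fun l => ?_, i, hi, ?_⟩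
  · simp only [Pi.zero_apply, Pi.sub_apply, Pi.smul_apply, smul_eq_mul, sub_nonneg]
    rcases (hw l).lt_or_eq with hl | hl
    · exact (div_le_iff₀ hl).1 (hmax l hl)
    · rw [← hl, h l hl.symm]; simp
  · simp [div_mul_cancel₀ _ hi.ne']

/-! ### Zeros of copositive matrices -/

section zeros

variable {n : ℕ} {A : SymMat n} {z : Fin n → ℝ}

theorem IsCopositive.bil_nonneg (hA : IsCopositive A) {x : Fin n → ℝ} (hx : 0 ≤ x) :
    0 ≤ bil A x x := hA x hx

theorem IsCopZero.bil_eq (hz : IsCopZero A z) : bil A z z = 0 := hz.2.2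

/-- The vector `z + t e_i` stays in the orthant for `t ≥ 0`, so the linear term in `t` cannot be
negative. The test value `t` has denominator `|a| + 1` so that it works for any sign of the diagonal
entry `a`. -/
theorem IsCopZero.mulVec_nonneg (hA : IsCopositive A) (hz : IsCopZero A z) (i : Fin n) :
    0 ≤ (A.1 *ᵥ z) i := by
  by_contra! h
  set b := (A.1 *ᵥ z) i with hb
  set a := A.1 i i with ha
  have h1 : ∀ t : ℝ, 0 ≤ t → 0 ≤ 2 * t * b + t ^ 2 * a := by
    intro t ht
    have h2 := hA.bil_nonneg (x := z + t • Pi.single i 1)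
      (add_nonneg hz.2.1 (smul_nonneg ht (Pi.single_nonneg.2 zero_le_one)))
    rw [bil_add_smul_self, hz.bil_eq, bil_comm A z, bil_single_left, bil_single_single] at h2
    linarith
  have hc : 0 < |a| + 1 := by positivity
  have h2 := h1 (-b / (|a| + 1)) (div_nonneg (by linarith) hc.le)
  have h3 : 2 * (-b / (|a| + 1)) * b + (-b / (|a| + 1)) ^ 2 * a
      = (b ^ 2 / (|a| + 1) ^ 2) * (a - 2 * (|a| + 1)) := by
    field_simp; ring
  rw [h3] at h2
  have h4 : 0 < b ^ 2 / (|a| + 1) ^ 2 := by have := h.ne; positivity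
  have h5 : a - 2 * (|a| + 1) < 0 := by have := le_abs_self a; have := abs_nonneg a; linarith
  nlinarith

theorem IsCopZero.mulVec_eq_zero (hA : IsCopositive A) (hz : IsCopZero A z) {i : Fin n}
    (hi : 0 < z i) : (A.1 *ᵥ z) i = 0 := by
  have h : ∑ k, z k * (A.1 *ᵥ z) k = 0 := hz.bil_eq
  rw [Finset.sum_eq_zero_iff_of_nonneg
    (fun k _ => mul_nonneg (hz.2.1 k) (hz.mulVec_nonneg hA k))] at h
  exact (mul_eq_zero.1 (h i (Finset.mem_univ i))).resolve_left hi.ne'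

theorem IsCopZero.bil_eq_zero_of_support (hA : IsCopositive A) (hz : IsCopZero A z)
    {x : Fin n → ℝ} (hx : ∀ i, z i = 0 → x i = 0) : bil A x z = 0 := by
  rw [bil_eq_sum]
  refine Finset.sum_eq_zero fun i _ => ?_
  by_cases h : z i = 0
  · rw [hx i h, zero_mul]
  · rw [hz.mulVec_eq_zero hA (lt_of_le_of_ne (hz.2.1 i) (Ne.symm h)), mul_zero]

/-- For large `c` the vector `c z - x` is nonnegative, and its form value equals that of `x`,
because `A z` vanishes on the support of `z`. Thus `A` is positive semi-definite on that coordinate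
subspace. -/
theorem IsCopZero.bil_nonneg_of_support (hA : IsCopositive A) (hz : IsCopZero A z)
    {x : Fin n → ℝ} (hx : ∀ i, z i = 0 → x i = 0) : 0 ≤ bil A x x := by
  obtain ⟨c, hc, -⟩ := exists_max_ratio hz.2.1 hz.1 hx
  have := hA.bil_nonneg hc
  rwa [bil_sub_self, bil_smul_left, bil_smul_right, bil_smul_left, bil_comm A z x,
    hz.bil_eq_zero_of_support hA hx, hz.bil_eq, mul_zero, mul_zero, mul_zero, sub_zero, zero_add] at this

theorem posSemidef_of_bil_nonneg (h : ∀ x, 0 ≤ bil A x x) : A.1.PosSemidef := by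
  refine Matrix.PosSemidef.of_dotProduct_mulVec_nonneg ?_ (fun x => h x)
  rw [Matrix.IsHermitian, Matrix.conjTranspose_eq_transpose_of_trivial]
  exact A.2

theorem IsExceptional.exists_bil_neg (hA : IsExceptional A) : ∃ x, bil A x x < 0 := by
  by_contra! h
  exact hA.2 ⟨A, 0, posSemidef_of_bil_nonneg h, fun i j => le_rfl, by simp⟩

end zeros

/-! ### Zeros with circulant supports -/

/-- `u r` is a zero of `A` whose support is the complement of `{r, r + 1}`. -/
def CirculantZeros {n : ℕ} (A : SymMat n) (u : Fin n → Fin n → ℝ) : Prop :=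
  ∀ r, IsCopZero A (u r) ∧ ∀ i, 0 < u r i ↔ i ≠ r ∧ i ≠ cyc r 1

section circulant

variable {n : ℕ} {A : SymMat n} {u : Fin n → Fin n → ℝ}

theorem CirculantZeros.eq_zero_iff (hu : CirculantZeros A u) (r i : Fin n) :
    u r i = 0 ↔ i = r ∨ i = cyc r 1 := by
  have h1 := (hu r).2 i
  have h2 : 0 ≤ u r i := (hu r).1.2.1 i
  constructor
  · intro h
    by_contra! h3
    exact (h1.2 h3).ne' h
  · intro h
    by_contra h3
    rcases h1.1 (lt_of_le_of_ne h2 (Ne.symm h3)) with ⟨h4, h5⟩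
    exact h.elim h4 h5

/-- The coefficient `θ` for which the form `xᵀ A x - 2 θ x_r x_{r+2}` is positive semi-definite on
`x_{r+1} = 0` and vanishes at `u r`. -/
noncomputable def theta (A : SymMat n) (u : Fin n → Fin n → ℝ) (r : Fin n) : ℝ :=
  (A.1 *ᵥ u r) r / u r (cyc r 2)

theorem CirculantZeros.pos (hu : CirculantZeros A u) {r i : Fin n} (h : i ≠ r)
    (h' : i ≠ cyc r 1) : 0 < u r i := ((hu r).2 i).2 ⟨h, h'⟩

theorem theta_nonneg (hA : IsCopositive A) (hu : CirculantZeros A u) (r : Fin n) :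
    0 ≤ theta A u r :=
  div_nonneg ((hu r).1.mulVec_nonneg hA r) ((hu r).1.2.1 _)

/-- Subtracting a multiple of `u r` from `x` kills the entry `r + 2`. The difference lives on the
support of `u (r + 1)`, where the form is nonnegative. The cross term with `u r` only sees the index
`r` and contributes the product with `θ`. -/
theorem two_theta_mul_le (hn : 5 ≤ n) (hA : IsCopositive A) (hu : CirculantZeros A u)
    {r : Fin n} {x : Fin n → ℝ} (hx : x (cyc r 1) = 0) :
    2 * theta A u r * (x r * x (cyc r 2)) ≤ bil A x x := by
  have hpos : 0 < u r (cyc r 2) := hu.pos (by simp (disch := omega) [cyc_eq_self_iff])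
    (by simp (disch := omega) [cyc_eq_iff])
  set a := x (cyc r 2) / u r (cyc r 2) with ha
  set y := x - a • u r with hy
  have h0 : u r r = 0 := (hu.eq_zero_iff r r).2 (Or.inl rfl)
  have h1 : u r (cyc r 1) = 0 := (hu.eq_zero_iff r _).2 (Or.inr rfl)
  have hyA : 0 ≤ bil A y y := by
    refine (hu (cyc r 1)).1.bil_nonneg_of_support hA fun i hi => ?_
    rw [hu.eq_zero_iff, cyc_cyc] at hi
    rcases hi with rfl | rfl
    · simp [hy, hx, h1]
    · simp [hy, ha, div_mul_cancel₀ _ hpos.ne']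
  have hux : bil A x (u r) = x r * (A.1 *ᵥ u r) r := by
    rw [bil_eq_sum, Finset.sum_eq_single r]
    · intro i _ hi
      by_cases h : i = cyc r 1
      · rw [h, hx, zero_mul]
      · rw [(hu r).1.mulVec_eq_zero hA (hu.pos hi h), mul_zero]
    · simp
  rw [hy, bil_sub_smul_self, (hu r).1.bil_eq, hux] at hyA
  have : 2 * theta A u r * (x r * x (cyc r 2)) = 2 * a * (x r * (A.1 *ᵥ u r) r) := by
    rw [theta, ha]; ring
  linarith

theorem bil_consecutive (hA : IsCopositive A) (hu : CirculantZeros A u)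
    (r : Fin n) : bil A (u (cyc r 1)) (u r) = u (cyc r 1) r * (A.1 *ᵥ u r) r := by
  rw [bil_eq_sum, Finset.sum_eq_single r]
  · intro i _ hi
    by_cases h : i = cyc r 1
    · rw [h, (hu.eq_zero_iff _ _).2 (Or.inl rfl), zero_mul]
    · rw [(hu r).1.mulVec_eq_zero hA (hu.pos hi h), mul_zero]
  · simp

theorem theta_eq_zero_iff (hn : 5 ≤ n) (hA : IsCopositive A) (hu : CirculantZeros A u)
    (r : Fin n) : theta A u r = 0 ↔ bil A (u (cyc r 1)) (u r) = 0 := by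
  have hpos : 0 < u r (cyc r 2) := hu.pos (by simp (disch := omega) [cyc_eq_self_iff])
    (by simp (disch := omega) [cyc_eq_iff])
  have hpos' : 0 < u (cyc r 1) r := hu.pos (by simp (disch := omega) [self_eq_cyc_iff])
    (by simp (disch := omega) [cyc_cyc, self_eq_cyc_iff])
  rw [bil_consecutive hA hu, theta, div_eq_zero_iff, mul_eq_zero]
  simp [hpos.ne', hpos'.ne']

/-- With `θ_r = 0` the form is nonnegative on all of `x_{r+1} = 0`. The combination of `u (s + 1)`
and `u s` that vanishes at `r + 1` has form value `-2c` times their product, with `c > 0`; this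
product is nonnegative, hence zero. -/
theorem theta_eq_zero_of_theta_eq_zero (hn : 5 ≤ n) (hA : IsCopositive A)
    (hu : CirculantZeros A u) {r s : Fin n} (h : theta A u r = 0)
    (h1 : cyc r 1 ≠ s) (h2 : cyc r 1 ≠ cyc s 1) (h3 : cyc r 1 ≠ cyc s 2) :
    theta A u s = 0 := by
  rw [theta_eq_zero_iff hn hA hu]
  have hp1 : 0 < u s (cyc r 1) := hu.pos h1 h2
  have hp2 : 0 < u (cyc s 1) (cyc r 1) := hu.pos h2 (by rwa [cyc_cyc])
  set c := u (cyc s 1) (cyc r 1) / u s (cyc r 1) with hc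
  have hc0 : 0 < c := div_pos hp2 hp1
  have key := two_theta_mul_le hn hA hu (r := r) (x := u (cyc s 1) - c • u s)
    (by simp [hc, div_mul_cancel₀ _ hp1.ne'])
  rw [h, bil_sub_smul_self, (hu s).1.bil_eq, (hu (cyc s 1)).1.bil_eq] at key
  have h5 : 0 ≤ bil A (u (cyc s 1)) (u s) := by
    rw [bil_eq_sum]
    exact Finset.sum_nonneg fun i _ =>
      mul_nonneg ((hu _).1.2.1 i) ((hu s).1.mulVec_nonneg hA i)
  nlinarith

/-- If one `θ` vanishes, all do. Then `u (r + 2)` lies in the kernel of `A`, and subtracting a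
multiple of it moves any vector into `x_{r+1} = 0`, where the form is nonnegative. So `A` would be
positive semi-definite. -/
theorem theta_pos (hn : 5 ≤ n) (hA : IsExceptional A) (hu : CirculantZeros A u) (r : Fin n) :
    0 < theta A u r := by
  refine lt_of_le_of_ne (theta_nonneg hA.1 hu r) fun h => ?_
  have step : ∀ s, theta A u s = 0 → theta A u (cyc s 1) = 0 := by
    intro s hs
    -- Vanishing cannot be passed from `s` to `s + 1` directly, since `s + 1` is an excluded index;
    -- it travels through `s + 3`. For `n = 5` the index `s + 5` wraps around to `s`.
    have h3 : theta A u (cyc s 3) = 0 := by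
      apply theta_eq_zero_of_theta_eq_zero hn hA.1 hu hs
      · simp (disch := omega) [cyc_eq_iff]
      · simp (disch := omega) [cyc_cyc, cyc_eq_iff]
      · rcases hn.lt_or_eq with hn | rfl
        · simp (disch := omega) [cyc_cyc, cyc_eq_iff]
        · rw [cyc_cyc, show 3 + 2 = 0 + 5 from rfl, cyc_add_period]
          simp (disch := omega) [cyc_eq_iff]
    apply theta_eq_zero_of_theta_eq_zero hn hA.1 hu h3 <;>
      simp (disch := omega) [cyc_cyc, cyc_eq_iff]
  have hall := cyc_induction (P := fun s => theta A u s = 0) r h.symm step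
  obtain ⟨x, hx⟩ := hA.exists_bil_neg
  have hr : ∀ s, (A.1 *ᵥ u s) s = 0 := by
    intro s
    have hpos : 0 < u s (cyc s 2) := hu.pos (by simp (disch := omega) [cyc_eq_self_iff])
      (by simp (disch := omega) [cyc_eq_iff])
    simpa [theta, hpos.ne'] using hall s
  have hr' : ∀ s, (A.1 *ᵥ u (cyc s 1)) (cyc s 2) = 0 := by
    intro s
    have hpos : 0 < u s (cyc s 2) := hu.pos (by simp (disch := omega) [cyc_eq_self_iff])
      (by simp (disch := omega) [cyc_eq_iff])
    have h1 := (theta_eq_zero_iff hn hA.1 hu s).1 (hall s)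
    rw [bil_comm, bil_eq_sum, Finset.sum_eq_zero_iff_of_nonneg (fun i _ =>
      mul_nonneg ((hu _).1.2.1 i) ((hu _).1.mulVec_nonneg hA.1 i))] at h1
    exact (mul_eq_zero.1 (h1 (cyc s 2) (Finset.mem_univ _))).resolve_left hpos.ne'
  have hker : ∀ i, (A.1 *ᵥ u (cyc r 2)) i = 0 := by
    intro i
    by_cases h1 : i = cyc r 2
    · rw [h1, hr]
    · by_cases h2 : i = cyc r 3
      · have := hr' (cyc r 1)
        rwa [cyc_cyc, cyc_cyc, ← h2] at this
      · exact (hu _).1.mulVec_eq_zero hA.1 (hu.pos h1 (by rwa [cyc_cyc]))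
  have hpos : 0 < u (cyc r 2) (cyc r 1) := hu.pos (by simp (disch := omega) [cyc_eq_iff])
    (by simp (disch := omega) [cyc_cyc, cyc_eq_iff])
  have hz : ∀ y, bil A y (u (cyc r 2)) = 0 := fun y => by
    rw [bil_eq_sum]; exact Finset.sum_eq_zero fun i _ => by rw [hker, mul_zero]
  have key := two_theta_mul_le hn hA.1 hu (r := r)
    (x := x - (x (cyc r 1) / u (cyc r 2) (cyc r 1)) • u (cyc r 2))
    (by simp [div_mul_cancel₀ _ hpos.ne'])
  rw [hall r, bil_sub_smul_self, hz, hz] at key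
  linarith

/-- The form `xᵀAx - 2 θ_r x_r x_{r+2}` is nonnegative on `x_{r+1} = 0` and takes the value zero at
`z`. Hence `z` is a minimizer there, and the gradient vanishes in all directions other than `r + 1`.
-/
theorem mulVec_zero_of_not_mem_support (hn : 5 ≤ n) (hA : IsExceptional A)
    (hu : CirculantZeros A u) {z : Fin n → ℝ} (hz : IsCopZero A z) {r : Fin n}
    (hr : z (cyc r 1) = 0) {i : Fin n} (hi : i ≠ cyc r 1) :
    (A.1 *ᵥ z) i = theta A u r *
      ((if i = r then z (cyc r 2) else 0) + (if i = cyc r 2 then z r else 0)) := by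
  have hne : r ≠ cyc r 2 := by simp (disch := omega) [self_eq_cyc_iff]
  have h0 : theta A u r * (z r * z (cyc r 2)) = 0 := by
    have h1 := two_theta_mul_le hn hA.1 hu hr
    rw [hz.bil_eq] at h1
    have h2 := mul_nonneg (theta_nonneg hA.1 hu r) (mul_nonneg (hz.2.1 r) (hz.2.1 (cyc r 2)))
    linarith
  rw [← sub_eq_zero]
  apply linear_coeff_eq_zero_of_nonneg (c := A.1 i i)
  intro t
  have h1 := two_theta_mul_le hn hA.1 hu (r := r) (x := z + t • Pi.single i 1)
    (by simp [hr, hi.symm])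
  rw [bil_add_smul_self, hz.bil_eq, bil_comm A z, bil_single_left, bil_single_single] at h1
  simp only [Pi.add_apply, Pi.smul_apply, smul_eq_mul, Pi.single_apply] at h1
  by_cases c1 : i = r
  · subst c1
    simp only [if_true, hne, hne.symm, if_false] at h1 ⊢
    nlinarith
  · by_cases c2 : i = cyc r 2
    · subst c2
      simp only [if_true, hne, hne.symm, if_false] at h1 ⊢
      nlinarith
    · simp only [c1, c2, Ne.symm c1, Ne.symm c2, if_false] at h1 ⊢
      nlinarith

end circulant

theorem cyc_injective {n : ℕ} (k : ℕ) : Function.Injective fun j : Fin n => cyc j k := by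
  intro a b h
  have h1 : (a.1 + k) ≡ (b.1 + k) [MOD n] := congrArg Fin.val h
  exact Fin.ext (Nat.ModEq.eq_of_lt_of_lt (Nat.ModEq.add_right_cancel' _ h1) a.2 b.2)

theorem exists_eq_cyc_one {n : ℕ} (hn : 0 < n) (m : Fin n) : ∃ r, m = cyc r 1 := by
  refine ⟨cyc m (n - 1), ?_⟩
  rw [cyc_cyc, show n - 1 + 1 = 0 + n by omega, cyc_add_period, cyc_zero]

/-! ### The zeros with smaller support -/

/-- The vectors `w r` are nonnegative with support the complement of `{r, r + 1, r + 2}`, and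
`A (w r)` is a positive multiple of the unit vector with index `r + 1`. -/
def MinimalCirculantZeros {n : ℕ} (A : SymMat n) (w : Fin n → Fin n → ℝ) : Prop :=
  ∀ r, 0 ≤ w r ∧ (∀ i, w r i = 0 ↔ i = r ∨ i = cyc r 1 ∨ i = cyc r 2) ∧
    (∀ i, i ≠ cyc r 1 → (A.1 *ᵥ w r) i = 0) ∧ 0 < (A.1 *ᵥ w r) (cyc r 1)

/-- The principal submatrices of `A` with index set the complement of `{r, r + 1, r + 2, r + 3}`
are nonsingular. -/
def NonsingularBlocks {n : ℕ} (A : SymMat n) : Prop :=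
  ∀ (r : Fin n) (y : Fin n → ℝ), y r = 0 → y (cyc r 1) = 0 → y (cyc r 2) = 0 → y (cyc r 3) = 0 →
    (∀ i, i ≠ r → i ≠ cyc r 1 → i ≠ cyc r 2 → i ≠ cyc r 3 → (A.1 *ᵥ y) i = 0) → y = 0

/-! ### Classification of the zeros by their vanishing sets. -/

section classification

variable {n : ℕ} {A : SymMat n} {u : Fin n → Fin n → ℝ}

/-- A zero with full support would make `A` positive semi-definite, so some vanishing entry `r + 1`
follows a positive entry `r`. Then `(A z)_{r+2} = θ_r z_r > 0`, which forces `z_{r+2} = 0`.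
Evaluating the same entry through any other vanishing index gives `0` unless that index is `r + 2`
or `r + 3`. -/
theorem exists_zero_pattern (hn : 5 ≤ n) (hA : IsExceptional A)
    (hu : CirculantZeros A u) {z : Fin n → ℝ} (hz : IsCopZero A z) :
    ∃ r, (∀ i, z i = 0 ↔ i = r ∨ i = cyc r 1) ∨
      (∀ i, z i = 0 ↔ i = r ∨ i = cyc r 1 ∨ i = cyc r 2) := by
  have hK : ∃ q, z q = 0 := by
    by_contra! h
    obtain ⟨x, hx⟩ := hA.exists_bil_neg
    exact absurd (hz.bil_nonneg_of_support hA.1 fun i hi => absurd hi (h i)) (not_le.2 hx)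
  obtain ⟨q, hq⟩ := hK
  obtain ⟨p, hp⟩ := Function.ne_iff.1 hz.1
  obtain ⟨r, hr, hr1⟩ : ∃ r, z r ≠ 0 ∧ z (cyc r 1) = 0 := by
    by_contra! h
    exact cyc_induction (P := fun s => z s ≠ 0) p hp h q hq
  have hrpos : 0 < z r := lt_of_le_of_ne (hz.2.1 r) (Ne.symm hr)
  have hpos : 0 < (A.1 *ᵥ z) (cyc r 2) := by
    rw [mulVec_zero_of_not_mem_support hn hA hu hz hr1 (by simp (disch := omega) [cyc_eq_iff])]
    have := theta_pos hn hA hu r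
    simp (disch := omega) only [cyc_eq_self_iff, if_true]
    simp [mul_pos this hrpos]
  have hr2 : z (cyc r 2) = 0 := by
    by_contra h
    exact hpos.ne' (hz.mulVec_eq_zero hA.1 (lt_of_le_of_ne (hz.2.1 _) (Ne.symm h)))
  have hsub : ∀ m, z m = 0 → m = cyc r 1 ∨ m = cyc r 2 ∨ m = cyc r 3 := by
    intro m hm
    obtain ⟨s, rfl⟩ := exists_eq_cyc_one (by omega) m
    by_contra! hcon
    obtain ⟨h1, h2, h3⟩ := hcon
    refine hpos.ne' ?_
    rw [mulVec_zero_of_not_mem_support hn hA hu hz hm h2.symm, if_neg, if_neg]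
    · simp
    · intro h
      exact h1 (congrArg (fun t => cyc t 1) (cyc_injective 2 h).symm)
    · intro h
      rw [← h, cyc_cyc] at h3
      exact h3 rfl
  refine ⟨cyc r 1, ?_⟩
  rw [cyc_cyc, cyc_cyc]
  by_cases h3 : z (cyc r 3) = 0
  · right
    intro i
    refine ⟨hsub i, ?_⟩
    rintro (rfl | rfl | rfl) <;> assumption
  · left
    intro i
    refine ⟨fun h => ?_, ?_⟩
    · rcases hsub i h with h' | h' | h'
      · exact Or.inl h'
      · exact Or.inr h'
      · exact absurd (h' ▸ h) h3
    · rintro (rfl | rfl) <;> assumption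

theorem mulVec_zero_of_pattern (hn : 5 ≤ n) (hA : IsExceptional A)
    (hu : CirculantZeros A u) {z : Fin n → ℝ} (hz : IsCopZero A z) {r : Fin n}
    (hr : ∀ i, z i = 0 ↔ i = r ∨ i = cyc r 1 ∨ i = cyc r 2) :
    (∀ i, i ≠ cyc r 1 → (A.1 *ᵥ z) i = 0) ∧ 0 < (A.1 *ᵥ z) (cyc r 1) := by
  have h0 : z r = 0 := (hr r).2 (by simp)
  have h1 : z (cyc r 1) = 0 := (hr _).2 (by simp)
  have h2 : z (cyc r 2) = 0 := (hr _).2 (by simp)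
  have h3 : z (cyc r 3) ≠ 0 := by
    rw [Ne, hr]
    simp (disch := omega) [cyc_eq_iff, cyc_eq_self_iff]
  refine ⟨fun i hi => ?_, ?_⟩
  · rw [mulVec_zero_of_not_mem_support hn hA hu hz h1 hi, h0, h2]
    simp
  · rw [mulVec_zero_of_not_mem_support hn hA hu hz (r := cyc r 1) (by rwa [cyc_cyc])
      (by simp (disch := omega) [cyc_cyc, cyc_eq_iff]), cyc_cyc, h1]
    simp only [if_true, ite_self, add_zero]
    exact mul_pos (theta_pos hn hA hu _) (lt_of_le_of_ne (hz.2.1 _) (Ne.symm h3))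

/-- The zero `c • u q - v`, with `c` the largest ratio of entries, loses one more support index. It
is positive at the entries where `v` vanishes outside `{q, q + 1}`, which later locates its
vanishing set. -/
theorem exists_zero_of_not_proportional (hA : IsExceptional A)
    (hu : CirculantZeros A u) {v : Fin n → ℝ} (hv : IsCopZero A v) {q : Fin n}
    (h0 : v q = 0) (h1 : v (cyc q 1) = 0) (hne : ∀ c : ℝ, v ≠ c • u q) :
    ∃ z, IsCopZero A z ∧ z q = 0 ∧ z (cyc q 1) = 0 ∧
      (∃ i, i ≠ q ∧ i ≠ cyc q 1 ∧ z i = 0) ∧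
      ∀ i, i ≠ q → i ≠ cyc q 1 → v i = 0 → 0 < z i := by
  have hsupp : ∀ i, u q i = 0 → v i = 0 := by
    intro i hi
    rcases (hu.eq_zero_iff q i).1 hi with rfl | rfl <;> assumption
  obtain ⟨c, hc, i, hi, hi0⟩ := exists_max_ratio (hu q).1.2.1 (hu q).1.1 hsupp
  have hcpos : 0 < c := by
    obtain ⟨k, hk⟩ := Function.ne_iff.1 hv.1
    have hk' : 0 < v k := lt_of_le_of_ne (hv.2.1 k) (Ne.symm hk)
    have h2 : 0 ≤ c * u q k - v k := hc k
    have h3 : 0 ≤ u q k := (hu q).1.2.1 k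
    by_contra! h4
    nlinarith
  refine ⟨c • u q - v, ⟨?_, hc, ?_⟩, ?_, ?_, ⟨i, ?_, ?_, hi0⟩, ?_⟩
  · exact fun h => hne c (sub_eq_zero.1 h).symm
  · change bil A _ _ = 0
    rw [bil_sub_self, bil_smul_left, bil_smul_left, bil_smul_right, (hu q).1.bil_eq, hv.bil_eq,
      bil_comm, (hu q).1.bil_eq_zero_of_support hA.1 hsupp]
    simp
  · simp [h0, (hu.eq_zero_iff q q).2 (Or.inl rfl)]
  · simp [h1, (hu.eq_zero_iff q (cyc q 1)).2 (Or.inr rfl)]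
  · exact (((hu q).2 i).1 hi).1
  · exact (((hu q).2 i).1 hi).2
  · intro k hk hk1 hvk
    have := mul_pos hcpos (hu.pos hk hk1)
    simpa [hvk] using this

theorem exists_triple_pattern (hn : 5 ≤ n) (hA : IsExceptional A)
    (hu : CirculantZeros A u) {z : Fin n → ℝ} (hz : IsCopZero A z) {q i : Fin n}
    (h0 : z q = 0) (h1 : z (cyc q 1) = 0) (hi : z i = 0) (hiq : i ≠ q) (hiq1 : i ≠ cyc q 1) :
    ∃ r, ∀ i, z i = 0 ↔ i = r ∨ i = cyc r 1 ∨ i = cyc r 2 := by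
  obtain ⟨r, hr | hr⟩ := exists_zero_pattern hn hA hu hz
  · exfalso
    have hq : cyc q 1 ≠ q := by simp (disch := omega) [cyc_eq_self_iff]
    rw [hr] at h0 h1 hi
    grind
  · exact ⟨r, hr⟩

theorem exists_triple_zero (hn : 5 ≤ n) (hA : IsExceptional A)
    (hu : CirculantZeros A u) {v : Fin n → ℝ} (hv : IsCopZero A v)
    (hne : ∀ q, ∀ c : ℝ, v ≠ c • u q) :
    ∃ w r, IsCopZero A w ∧ ∀ i, w i = 0 ↔ i = r ∨ i = cyc r 1 ∨ i = cyc r 2 := by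
  obtain ⟨r, hr | hr⟩ := exists_zero_pattern hn hA hu hv
  · obtain ⟨z, hz, hz0, hz1, ⟨i, hi, hi1, hi0⟩, -⟩ := exists_zero_of_not_proportional hA hu hv
      ((hr r).2 (Or.inl rfl)) ((hr _).2 (Or.inr rfl)) (hne r)
    obtain ⟨s, hs⟩ := exists_triple_pattern hn hA hu hz hz0 hz1 hi0 hi hi1
    exact ⟨z, s, hz, hs⟩
  · exact ⟨v, r, hv, hr⟩

/-- The zero `w` is subtracted from a multiple of `u (r + 1)`. The result has three consecutive
vanishing indices including `r + 1` and `r + 2`, but it is positive at `r`, so they begin at `r +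
1`. -/
theorem exists_next_triple_zero (hn : 5 ≤ n) (hA : IsExceptional A)
    (hu : CirculantZeros A u) {w : Fin n → ℝ} (hw : IsCopZero A w) {r : Fin n}
    (hr : ∀ i, w i = 0 ↔ i = r ∨ i = cyc r 1 ∨ i = cyc r 2) :
    ∃ z, IsCopZero A z ∧
      ∀ i, z i = 0 ↔ i = cyc r 1 ∨ i = cyc (cyc r 1) 1 ∨ i = cyc (cyc r 1) 2 := by
  have h0 : w r = 0 := (hr r).2 (by simp)
  have h1 : w (cyc r 1) = 0 := (hr _).2 (by simp)
  have h2 : w (cyc r 2) = 0 := (hr _).2 (by simp)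
  have hr1 : r ≠ cyc r 1 := by simp (disch := omega) [self_eq_cyc_iff]
  have hr2 : r ≠ cyc r 2 := by simp (disch := omega) [self_eq_cyc_iff]
  obtain ⟨z, hz, hz0, hz1, ⟨i, hi, hi1, hi0⟩, hzpos⟩ :=
    exists_zero_of_not_proportional hA hu (q := cyc r 1) hw h1 (by rwa [cyc_cyc]) (by
      rintro c rfl
      have hpos : 0 < u (cyc r 1) r := hu.pos hr1 (by rwa [cyc_cyc])
      rw [Pi.smul_apply, smul_eq_mul, mul_eq_zero, or_iff_left hpos.ne'] at h0
      exact hw.1 (by simp [h0]))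
  have hzr : 0 < z r := hzpos r hr1 (by rwa [cyc_cyc]) h0
  obtain ⟨s, hs⟩ := exists_triple_pattern hn hA hu hz hz0 hz1 hi0 hi hi1
  suffices cyc r 1 = s by exact ⟨z, hz, this ▸ hs⟩
  rcases (hs _).1 hz0 with h | h | h
  · exact h
  · have : r = s := cyc_injective 1 h
    exact absurd ((hs r).2 (Or.inl this)) hzr.ne'
  · have : r = cyc s 1 := cyc_injective 1 (by simpa [cyc_cyc] using h)
    exact absurd ((hs r).2 (Or.inr (Or.inl this))) hzr.ne'

theorem exists_minimalCirculantZeros (hn : 5 ≤ n) (hA : IsExceptional A)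
    (hu : CirculantZeros A u) {v : Fin n → ℝ} (hv : IsCopZero A v)
    (hne : ∀ q, ∀ c : ℝ, v ≠ c • u q) :
    ∃ w, MinimalCirculantZeros A w := by
  obtain ⟨w, r, hw, hwr⟩ := exists_triple_zero hn hA hu hv hne
  have hall := cyc_induction (P := fun r => ∃ z, IsCopZero A z ∧
      ∀ i, z i = 0 ↔ i = r ∨ i = cyc r 1 ∨ i = cyc r 2) r ⟨w, hw, hwr⟩
    fun s ⟨z, hz, hs⟩ => exists_next_triple_zero hn hA hu hz hs
  choose w hw hwr using hall
  exact ⟨w, fun r => ⟨(hw r).2.1, hwr r, mulVec_zero_of_pattern hn hA hu (hw r) (hwr r)⟩⟩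

end classification

/-! ### Rigidity and linear independence of the minimal zeros. -/

section minimal

variable {n : ℕ} {A : SymMat n} {w : Fin n → Fin n → ℝ}

theorem MinimalCirculantZeros.pos (hw : MinimalCirculantZeros A w) {r i : Fin n} (h : i ≠ r)
    (h1 : i ≠ cyc r 1) (h2 : i ≠ cyc r 2) : 0 < w r i := by
  refine lt_of_le_of_ne ((hw r).1 i) fun h3 => ?_
  rcases ((hw r).2.1 i).1 h3.symm with h4 | h4 | h4 <;> contradiction

theorem MinimalCirculantZeros.bil_eq (hw : MinimalCirculantZeros A w) (x : Fin n → ℝ)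
    (r : Fin n) : bil A x (w r) = x (cyc r 1) * (A.1 *ᵥ w r) (cyc r 1) := by
  rw [bil_eq_sum, Finset.sum_eq_single (cyc r 1)]
  · intro i _ hi
    rw [(hw r).2.2.1 i hi, mul_zero]
  · simp

theorem MinimalCirculantZeros.bil_self (hw : MinimalCirculantZeros A w) (r : Fin n) :
    bil A (w r) (w r) = 0 := by
  rw [hw.bil_eq, ((hw r).2.1 _).2 (by simp), zero_mul]

theorem MinimalCirculantZeros.ne_zero (hw : MinimalCirculantZeros A w) (r : Fin n) :
    w r ≠ 0 := by
  intro h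
  have := (hw r).2.2.2
  rw [h] at this
  simp at this

theorem MinimalCirculantZeros.isCopZero (hw : MinimalCirculantZeros A w) (r : Fin n) :
    IsCopZero A (w r) := ⟨hw.ne_zero r, (hw r).1, hw.bil_self r⟩

/-- For a kernel vector `y` of the block, `c • w r - y` with the ratio-test `c` would, if nonzero,
be a zero of `A` vanishing at `r, r + 1, r + 2` and at one further index, against the
classification. If it is zero, the entry `r + 3` gives `c = 0`. -/
theorem nonsingularBlocks_of_exceptional (hn : 5 ≤ n) (hA : IsExceptional A)
    {u : Fin n → Fin n → ℝ} (hu : CirculantZeros A u) (hw : MinimalCirculantZeros A w) :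
    NonsingularBlocks A := by
  intro r y h0 h1 h2 h3 hy
  have hyy : bil A y y = 0 := by
    rw [bil_eq_sum]
    refine Finset.sum_eq_zero fun i _ => ?_
    by_cases c0 : i = r
    · rw [c0, h0, zero_mul]
    by_cases c1 : i = cyc r 1
    · rw [c1, h1, zero_mul]
    by_cases c2 : i = cyc r 2
    · rw [c2, h2, zero_mul]
    by_cases c3 : i = cyc r 3
    · rw [c3, h3, zero_mul]
    rw [hy i c0 c1 c2 c3, mul_zero]
  obtain ⟨c, hc, i, hi, hi0⟩ := exists_max_ratio (x := y) (hw r).1 (hw.ne_zero r) (by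
    intro i hi
    rcases ((hw r).2.1 i).1 hi with rfl | rfl | rfl <;> assumption)
  by_cases hz : c • w r - y = 0
  · have hpos : 0 < w r (cyc r 3) := by
      apply hw.pos <;> simp (disch := omega) [cyc_eq_iff, cyc_eq_self_iff]
    have := congrFun hz (cyc r 3)
    simp only [Pi.sub_apply, Pi.smul_apply, smul_eq_mul, h3, sub_zero, Pi.zero_apply,
      mul_eq_zero, hpos.ne', or_false] at this
    rw [this, zero_smul, zero_sub, neg_eq_zero] at hz
    exact hz
  · exfalso
    have hzero : IsCopZero A (c • w r - y) := by
      refine ⟨hz, hc, ?_⟩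
      change bil A _ _ = 0
      rw [bil_sub_self, bil_smul_left, bil_smul_left, bil_smul_right, hw.bil_self, hyy, bil_comm,
        hw.bil_eq, h1]
      simp
    have e0 : (c • w r - y) r = 0 := by simp [h0, ((hw r).2.1 r).2 (by simp)]
    have e1 : (c • w r - y) (cyc r 1) = 0 := by simp [h1, ((hw r).2.1 (cyc r 1)).2 (by simp)]
    have e2 : (c • w r - y) (cyc r 2) = 0 := by simp [h2, ((hw r).2.1 (cyc r 2)).2 (by simp)]
    have hi' : ¬(i = r ∨ i = cyc r 1 ∨ i = cyc r 2) := fun h => hi.ne' (((hw r).2.1 i).2 h)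
    have d1 : r ≠ cyc r 1 := by simp (disch := omega) [self_eq_cyc_iff]
    have d2 : r ≠ cyc r 2 := by simp (disch := omega) [self_eq_cyc_iff]
    have d3 : cyc r 1 ≠ cyc r 2 := by simp (disch := omega) [cyc_eq_iff]
    obtain ⟨s, hs | hs⟩ := exists_zero_pattern hn hA hu hzero
    · rw [hs] at e0 e1 e2
      grind
    · rw [hs] at e0 e1 e2 hi0
      grind

theorem MinimalCirculantZeros.eq_smul (hn : 5 ≤ n) (hw : MinimalCirculantZeros A w)
    (hA : NonsingularBlocks A) {r : Fin n} {y : Fin n → ℝ}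
    (h0 : y r = 0) (h1 : y (cyc r 1) = 0) (h2 : y (cyc r 2) = 0)
    (hy : ∀ i, i ≠ r → i ≠ cyc r 1 → i ≠ cyc r 2 → i ≠ cyc r 3 → (A.1 *ᵥ y) i = 0) :
    ∃ c : ℝ, y = c • w r := by
  have hpos : 0 < w r (cyc r 3) := by
    apply hw.pos <;> simp (disch := omega) [cyc_eq_iff, cyc_eq_self_iff]
  refine ⟨y (cyc r 3) / w r (cyc r 3), sub_eq_zero.1 (hA r _ ?_ ?_ ?_ ?_ ?_)⟩
  · simp [h0, ((hw r).2.1 r).2 (by simp)]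
  · simp [h1, ((hw r).2.1 (cyc r 1)).2 (by simp)]
  · simp [h2, ((hw r).2.1 (cyc r 2)).2 (by simp)]
  · simp [div_mul_cancel₀ _ hpos.ne']
  · intro i c0 c1 c2 c3
    rw [Matrix.mulVec_sub, Matrix.mulVec_smul, Pi.sub_apply, Pi.smul_apply, hy i c0 c1 c2 c3,
      (hw r).2.2.1 i c1]
    simp

/-- The matrix with columns `w r` is invertible. -/
theorem MinimalCirculantZeros.det_ne_zero (hw : MinimalCirculantZeros A w) :
    (Matrix.of fun i r => w r i).det ≠ 0 := by
  intro h
  obtain ⟨c, hc, hc0⟩ := Matrix.exists_mulVec_eq_zero_iff.2 h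
  apply hc
  funext s
  have h1 : ∑ r, c r • w r = 0 := by
    rw [← hc0]
    funext i
    simp [Matrix.mulVec, dotProduct, mul_comm]
  have h2 := congrFun (congrArg (fun x => A.1 *ᵥ x) h1) (cyc s 1)
  simp only [Matrix.mulVec_sum, Finset.sum_apply, Matrix.mulVec_smul, Pi.smul_apply,
    Matrix.mulVec_zero, Pi.zero_apply] at h2
  rw [Finset.sum_eq_single s] at h2
  · exact (smul_eq_zero.1 h2).resolve_right (hw s).2.2.2.ne'
  · intro r _ hr
    rw [(hw r).2.2.1 _ (fun h => hr (cyc_injective 1 h).symm), smul_zero]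
  · simp

theorem MinimalCirculantZeros.matrix_eq_zero (hw : MinimalCirculantZeros A w)
    {C : Matrix (Fin n) (Fin n) ℝ} (hC : ∀ r, C *ᵥ w r = 0) : C = 0 := by
  have hU : IsUnit (Matrix.of fun i r => w r i) :=
    (Matrix.isUnit_iff_isUnit_det _).2 (isUnit_iff_ne_zero.2 hw.det_ne_zero)
  rw [← hU.mul_left_eq_zero]
  ext i r
  exact congrFun (hC r) i

end minimal

/-! ### Exceptionality and extremality -/

section extremal

variable {n : ℕ} {A : SymMat n} {w : Fin n → Fin n → ℝ}

theorem mulVec_apply_eq_sum (M : Matrix (Fin n) (Fin n) ℝ) (y : Fin n → ℝ) (i : Fin n) :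
    (M *ᵥ y) i = ∑ k, M i k * y k := rfl

theorem exists_pattern_avoiding (hn : 5 ≤ n) (i k : Fin n) :
    ∃ r, i ≠ cyc r 1 ∧ k ≠ r ∧ k ≠ cyc r 1 ∧ k ≠ cyc r 2 := by
  by_cases h : i = cyc k 2
  · refine ⟨cyc k 2, ?_⟩
    rw [h]
    simp (disch := omega) [cyc_cyc, cyc_eq_iff, self_eq_cyc_iff]
  · refine ⟨cyc k 1, ?_⟩
    simp (disch := omega) [cyc_cyc, self_eq_cyc_iff, h]

/-- In a decomposition `P + N` the semi-definite part annihilates every `w r`, so `N (w r) = A (w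
r)` vanishes off `r + 1`. For each entry `(i, k)` some `r` has `i ≠ r + 1` and `w r` positive at
`k`, so `N = 0`. This contradicts `A (w r) ≠ 0`. -/
theorem MinimalCirculantZeros.isExceptional (hn : 5 ≤ n) (hA : IsCopositive A)
    (hw : MinimalCirculantZeros A w) : IsExceptional A := by
  refine ⟨hA, ?_⟩
  rintro ⟨P, N, hP, hN, rfl⟩
  have hPnn : ∀ x, 0 ≤ bil P x x := fun x => by
    simpa [bil] using hP.dotProduct_mulVec_nonneg x
  have hNw : ∀ r i, 0 ≤ (N.1 *ᵥ w r) i := fun r i => by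
    rw [mulVec_apply_eq_sum]
    exact Finset.sum_nonneg fun k _ => mul_nonneg (hN i k) ((hw r).1 k)
  have hPw : ∀ r i, (P.1 *ᵥ w r) i = 0 := by
    intro r i
    have h1 := hw.bil_self r
    rw [bil_add_matrix] at h1
    have h2 : 0 ≤ bil N (w r) (w r) := by
      rw [bil_eq_sum]
      exact Finset.sum_nonneg fun k _ => mul_nonneg ((hw r).1 k) (hNw r k)
    have h3 : bil P (w r) (w r) = 0 := le_antisymm (by linarith) (hPnn _)
    rw [← bil_single_left, bil_comm]
    exact bil_eq_zero_of_nonneg P (fun t => hPnn _) h3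
  have hAN : ∀ r i, ((P + N : SymMat n).1 *ᵥ w r) i = (N.1 *ᵥ w r) i := by
    intro r i
    change ((P.1 + N.1) *ᵥ w r) i = _
    rw [Matrix.add_mulVec, Pi.add_apply, hPw, zero_add]
  have hN0 : N.1 = 0 := by
    ext i k
    obtain ⟨r, hi, h0, h1, h2⟩ := exists_pattern_avoiding hn i k
    have h3 := (hw r).2.2.1 i hi
    rw [hAN] at h3
    change ∑ k, N.1 i k * w r k = 0 at h3
    rw [Finset.sum_eq_zero_iff_of_nonneg
      (fun k _ => mul_nonneg (hN i k) ((hw r).1 k))] at h3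
    exact (mul_eq_zero.1 (h3 k (Finset.mem_univ k))).resolve_right (hw.pos h0 h1 h2).ne'
  by_cases hr : Nonempty (Fin n)
  · obtain ⟨r⟩ := hr
    have h4 := (hw r).2.2.2
    rw [hAN, hN0] at h4
    simp at h4
  · exact hr ⟨⟨0, by omega⟩⟩

/-- For a summand `B`, the vector `B (w r)` is again supported at `r + 1`. As the `w r` form a
basis, `B = diag(l) A`. Symmetry decouples indices with different `l`, and the nonsingular blocks
exclude such a decoupling. -/
theorem MinimalCirculantZeros.isExtremal (hn : 5 ≤ n) (hA : IsCopositive A)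
    (hw : MinimalCirculantZeros A w) (hND : NonsingularBlocks A) : IsExtremal A := by
  let r₀ : Fin n := ⟨0, by omega⟩
  have hdiag : ∀ i, 0 ≤ A.1 i i := fun i => by
    rw [← bil_single_single]
    exact hA.bil_nonneg (Pi.single_nonneg.2 zero_le_one)
  -- A nonnegative vector with positive form value: it shows `A ≠ 0` and fixes the sign of the
  -- factor between `B` and `A`.
  set x₀ : Fin n → ℝ := w r₀ + Pi.single (cyc r₀ 1) 1 with hx₀
  have hx₀nn : 0 ≤ x₀ := add_nonneg (hw r₀).1 (Pi.single_nonneg.2 zero_le_one)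
  have hx₀A : 0 < bil A x₀ x₀ := by
    rw [hx₀, bil_add_self, hw.bil_self, bil_comm, bil_single_left, bil_single_single]
    have := (hw r₀).2.2.2
    have := hdiag (cyc r₀ 1)
    linarith
  suffices h : ∀ B C : SymMat n, IsCopositive B → IsCopositive C → A = B + C →
      ∃ b : ℝ, 0 ≤ b ∧ B = b • A by
    refine ⟨?_, hA, fun B C hB hC hBC => ?_⟩
    · rintro rfl
      simp [bil] at hx₀A
    · obtain ⟨b, hb, hbA⟩ := h B C hB hC hBC
      obtain ⟨c, hc, hcA⟩ := h C B hC hB (by rw [hBC, add_comm])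
      exact ⟨b, c, hb, hc, hbA, hcA⟩
  intro B C hB hC hBC
  have hsum : ∀ r i, (A.1 *ᵥ w r) i = (B.1 *ᵥ w r) i + (C.1 *ᵥ w r) i := by
    intro r i
    rw [hBC]
    change ((B.1 + C.1) *ᵥ w r) i = _
    rw [Matrix.add_mulVec, Pi.add_apply]
  have hz : ∀ r, IsCopZero B (w r) ∧ IsCopZero C (w r) := by
    intro r
    have h1 := hw.bil_self r
    rw [hBC, bil_add_matrix] at h1
    have h2 := hB.bil_nonneg (hw r).1
    have h3 := hC.bil_nonneg (hw r).1
    have h4 : bil B (w r) (w r) = 0 := by linarith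
    have h5 : bil C (w r) (w r) = 0 := by linarith
    exact ⟨⟨hw.ne_zero r, (hw r).1, h4⟩, ⟨hw.ne_zero r, (hw r).1, h5⟩⟩
  have hBw : ∀ r i, i ≠ cyc r 1 → (B.1 *ᵥ w r) i = 0 := by
    intro r i hi
    have h1 := hsum r i
    rw [(hw r).2.2.1 i hi] at h1
    have h2 := (hz r).1.mulVec_nonneg hB i
    have h3 := (hz r).2.mulVec_nonneg hC i
    linarith
  have hlam : ∀ i, ∃ l : ℝ, ∀ r, (B.1 *ᵥ w r) i = l * (A.1 *ᵥ w r) i := by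
    intro i
    obtain ⟨s, rfl⟩ := exists_eq_cyc_one (by omega) i
    refine ⟨(B.1 *ᵥ w s) (cyc s 1) / (A.1 *ᵥ w s) (cyc s 1), fun r => ?_⟩
    by_cases h : cyc s 1 = cyc r 1
    · obtain rfl : s = r := cyc_injective 1 h
      rw [div_mul_cancel₀ _ (hw s).2.2.2.ne']
    · rw [hBw r _ h, (hw r).2.2.1 _ h, mul_zero]
  choose l hl using hlam
  have hBA : ∀ i k, B.1 i k = l i * A.1 i k := by
    have h0 := hw.matrix_eq_zero (C := B.1 - Matrix.diagonal l * A.1) (fun r => by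
      funext i
      rw [Matrix.sub_mulVec, ← Matrix.mulVec_mulVec, Pi.sub_apply, Matrix.mulVec_diagonal,
        hl i r, sub_self, Pi.zero_apply])
    intro i k
    have := congrFun (congrFun h0 i) k
    simpa [Matrix.diagonal_mul, sub_eq_zero] using this
  have hoff : ∀ i k, l i ≠ l k → A.1 i k = 0 := by
    intro i k h
    have h1 := hBA i k
    have h2 := hBA k i
    rw [A.2.apply i k] at h2
    rw [B.2.apply i k, h1] at h2
    by_contra h3
    exact h (mul_right_cancel₀ h3 h2)
  have hstep : ∀ j, l j = l r₀ → l (cyc j 1) = l r₀ := by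
    intro j hj
    rw [← hj]
    by_contra hne
    classical
    set r := cyc j 2 with hr
    have d : r ≠ j ∧ cyc r 1 ≠ j ∧ cyc r 2 ≠ j ∧ r ≠ cyc j 1 ∧ cyc r 1 ≠ cyc j 1 ∧
        cyc r 2 ≠ cyc j 1 := by
      simp (disch := omega) [hr, cyc_cyc, cyc_eq_iff, cyc_eq_self_iff]
    obtain ⟨d1, d2, d3, d4, d5, d6⟩ := d
    -- Since `A` has no entries between different level sets of `l`, restricting `w r` to one level
    -- set preserves the kernel equations, so `y` is a multiple of `w r`. With `r = j + 2` both `j`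
    -- and `j + 1` lie in the support of `w r`, yet only `j` survives the restriction.
    set y : Fin n → ℝ := fun k => if l k = l j then w r k else 0 with hy
    have hy0 : ∀ k, w r k = 0 → y k = 0 := fun k hk => by simp [hy, hk]
    obtain ⟨c, hc⟩ := hw.eq_smul hn hND (r := r) (y := y)
      (hy0 _ (((hw r).2.1 _).2 (by simp))) (hy0 _ (((hw r).2.1 _).2 (by simp)))
      (hy0 _ (((hw r).2.1 _).2 (by simp))) (by
        intro i c0 c1 c2 c3
        by_cases hi : l i = l j
        · rw [← (hw r).2.2.1 i c1, mulVec_apply_eq_sum, mulVec_apply_eq_sum]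
          refine Finset.sum_congr rfl fun k _ => ?_
          by_cases hk : l k = l j
          · simp [hy, hk]
          · rw [hoff i k (by rw [hi]; exact Ne.symm hk), zero_mul, zero_mul]
        · rw [mulVec_apply_eq_sum]
          refine Finset.sum_eq_zero fun k _ => ?_
          by_cases hk : l k = l j
          · rw [hoff i k (by rw [hk]; exact hi), zero_mul]
          · simp [hy, hk])
    have e1 := congrFun hc j
    have e2 := congrFun hc (cyc j 1)
    have p1 : 0 < w r j := hw.pos d1.symm d2.symm d3.symm
    have p2 : 0 < w r (cyc j 1) := hw.pos d4.symm d5.symm d6.symm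
    simp only [hy, if_true, hne, if_false, Pi.smul_apply, smul_eq_mul] at e1 e2
    rw [(mul_eq_zero.1 e2.symm).resolve_right p2.ne', zero_mul] at e1
    exact p1.ne' e1
  have hconst := cyc_induction (P := fun j => l j = l r₀) r₀ rfl hstep
  have hBl : B = l r₀ • A := by
    apply Subtype.ext
    ext i k
    rw [hBA, hconst i]
    rfl
  refine ⟨l r₀, ?_, hBl⟩
  have h1 := hB.bil_nonneg hx₀nn
  have h2 : bil B x₀ x₀ = l r₀ * bil A x₀ x₀ := by
    rw [hBl]
    change x₀ ⬝ᵥ ((l r₀ • A.1) *ᵥ x₀) = _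
    rw [Matrix.smul_mulVec, dotProduct_smul]
    rfl
  rw [h2] at h1
  exact nonneg_of_mul_nonneg_left h1 hx₀A

/-! ### Index sets as complements, and the circulant zero supports. -/

theorem mem_range_idxI (hn : 5 ≤ n) (j i : Fin n) :
    i ∈ Set.range (idxI j) ↔ i ≠ cyc j (n - 2) ∧ i ≠ cyc j (n - 1) := by
  constructor
  · rintro ⟨⟨k, hk⟩, rfl⟩
    simp only [idxI, ne_eq]
    rw [cyc_eq_iff (by omega) (by omega), cyc_eq_iff (by omega) (by omega)]
    omega
  · rintro ⟨h1, h2⟩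
    obtain ⟨k, hk, rfl⟩ := exists_eq_cyc j i
    rw [Ne, cyc_eq_iff hk (by omega)] at h1 h2
    exact ⟨⟨k, by omega⟩, rfl⟩

theorem mem_range_idxI' (hn : 5 ≤ n) (j i : Fin n) :
    i ∈ Set.range (idxI' j) ↔
      i ≠ cyc j (n - 3) ∧ i ≠ cyc j (n - 2) ∧ i ≠ cyc j (n - 1) := by
  constructor
  · rintro ⟨⟨k, hk⟩, rfl⟩
    simp only [idxI', ne_eq]
    rw [cyc_eq_iff (by omega) (by omega), cyc_eq_iff (by omega) (by omega),
      cyc_eq_iff (by omega) (by omega)]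
    omega
  · rintro ⟨h1, h2, h3⟩
    obtain ⟨k, hk, rfl⟩ := exists_eq_cyc j i
    rw [Ne, cyc_eq_iff hk (by omega)] at h1 h2 h3
    exact ⟨⟨k, by omega⟩, rfl⟩

theorem idxI_injective (j : Fin n) : Function.Injective (idxI j) := by
  rintro ⟨a, ha⟩ ⟨b, hb⟩ h
  exact Fin.ext ((cyc_eq_iff (j := j) (by omega) (by omega)).1 h)

theorem idxI'_injective (j : Fin n) : Function.Injective (idxI' j) := by
  rintro ⟨a, ha⟩ ⟨b, hb⟩ h
  exact Fin.ext ((cyc_eq_iff (j := j) (by omega) (by omega)).1 h)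

theorem exists_circulantZeros (hn : 5 ≤ n) (hA : HasNonMinimalCirculantZeroSupport A) :
    ∃ u v, CirculantZeros A u ∧ IsCopZero A v ∧ ∀ q, ∀ c : ℝ, v ≠ c • u q := by
  obtain ⟨-, u, hu, v, hv, hne⟩ := hA
  -- The complement of `I_{r+2}` is `{r, r + 1}`, whence the shift by two.
  refine ⟨fun r => u (cyc r 2), v, fun r => ⟨(hu _).1, fun i => ?_⟩, hv,
    fun q c h => hne (cyc q 2) ⟨c, h⟩⟩
  have h := Set.ext_iff.1 (hu (cyc r 2)).2 i
  rw [mem_range_idxI hn, cyc_cyc, cyc_cyc, show 2 + (n - 2) = 0 + n by omega,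
    show 2 + (n - 1) = 1 + n by omega, cyc_add_period, cyc_add_period, cyc_zero] at h
  exact h

/-- The sums `w s + w (s + 1)` are zeros vanishing exactly at `s + 1` and `s + 2`; the choice `s = j
+ n - 3` yields support `I_j`. A single `w r` vanishes at three indices, so it is proportional to
none of them. -/
theorem MinimalCirculantZeros.hasNonMinimalCirculantZeroSupport (hn : 5 ≤ n)
    (hA : IsCopositive A) (hw : MinimalCirculantZeros A w) :
    HasNonMinimalCirculantZeroSupport A := by
  have hsupp : ∀ s i, 0 < (w s + w (cyc s 1)) i ↔ i ≠ cyc s 1 ∧ i ≠ cyc s 2 := by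
    intro s i
    have h1 : 0 ≤ w s i := (hw _).1 i
    have h2 : 0 ≤ w (cyc s 1) i := (hw _).1 i
    have h3 := (hw s).2.1 i
    have h4 := (hw (cyc s 1)).2.1 i
    rw [cyc_cyc, cyc_cyc] at h4
    have h5 : s ≠ cyc s 3 := by simp (disch := omega) [self_eq_cyc_iff]
    rw [Pi.add_apply, (add_nonneg h1 h2).lt_iff_ne, ne_comm, Ne,
      add_eq_zero_iff_of_nonneg h1 h2, h3, h4]
    grind
  have hzero : ∀ s, IsCopZero A (w s + w (cyc s 1)) := by
    intro s
    refine ⟨fun h => ?_, add_nonneg (hw _).1 (hw _).1, ?_⟩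
    · have h1 := (hsupp s s).2 (by simp (disch := omega) [self_eq_cyc_iff])
      rw [h] at h1
      exact lt_irrefl _ h1
    · change bil A _ _ = 0
      rw [bil_add_self, hw.bil_self, hw.bil_self, bil_comm, hw.bil_eq, ((hw _).2.1 _).2]
      · simp
      · exact Or.inl rfl
  refine ⟨hw.isExceptional hn hA, fun j => w (cyc j (n - 3)) + w (cyc (cyc j (n - 3)) 1),
    fun j => ⟨hzero _, ?_⟩, w ⟨0, by omega⟩, hw.isCopZero _, ?_⟩
  · ext i
    rw [mem_range_idxI hn, Set.mem_ofPred_eq, hsupp, cyc_cyc, cyc_cyc,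
      show n - 3 + 1 = n - 2 by omega, show n - 3 + 2 = n - 1 by omega]
  · generalize (⟨0, by omega⟩ : Fin n) = r
    rintro j ⟨c, hc⟩
    set s := cyc j (n - 3)
    have hc0 : c ≠ 0 := by
      rintro rfl
      exact hw.ne_zero r (by rw [hc, zero_smul])
    have h1 : ∀ i, w r i = 0 → i = cyc s 1 ∨ i = cyc s 2 := by
      intro i hi
      by_contra! h
      have h2 := (hsupp s i).2 h
      rw [hc, Pi.smul_apply, smul_eq_mul] at hi
      exact (mul_ne_zero hc0 h2.ne') hi
    have e0 := h1 r (((hw r).2.1 _).2 (by simp))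
    have e1 := h1 (cyc r 1) (((hw r).2.1 _).2 (by simp))
    have e2 := h1 (cyc r 2) (((hw r).2.1 _).2 (by simp))
    have d1 : r ≠ cyc r 1 := by simp (disch := omega) [self_eq_cyc_iff]
    have d2 : r ≠ cyc r 2 := by simp (disch := omega) [self_eq_cyc_iff]
    have d3 : cyc r 1 ≠ cyc r 2 := by simp (disch := omega) [cyc_eq_iff]
    grind

end extremal

/-! ### Submatrices -/

section submatrix

variable {n : ℕ}

theorem cyc_surjective (k : ℕ) : Function.Surjective fun j : Fin n => cyc j k :=
  Finite.injective_iff_surjective.1 (cyc_injective k)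

theorem mem_range_idxI_cyc (hn : 5 ≤ n) (r i : Fin n) :
    i ∈ Set.range (idxI (cyc r 3)) ↔ i ≠ cyc r 1 ∧ i ≠ cyc r 2 := by
  rw [mem_range_idxI hn, cyc_cyc, cyc_cyc, show 3 + (n - 2) = 1 + n by omega,
    show 3 + (n - 1) = 2 + n by omega, cyc_add_period, cyc_add_period]

theorem mem_range_idxI'_cyc (hn : 5 ≤ n) (r i : Fin n) :
    i ∈ Set.range (idxI' (cyc r 3)) ↔ i ≠ r ∧ i ≠ cyc r 1 ∧ i ≠ cyc r 2 := by
  rw [mem_range_idxI' hn, cyc_cyc, cyc_cyc, cyc_cyc, show 3 + (n - 3) = 0 + n by omega,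
    show 3 + (n - 2) = 1 + n by omega, show 3 + (n - 1) = 2 + n by omega, cyc_add_period,
    cyc_add_period, cyc_add_period, cyc_zero]

theorem mulVec_submatrix {m l : ℕ} (M : Matrix (Fin n) (Fin n) ℝ) (f : Fin l → Fin n)
    {e : Fin m → Fin n} (he : Function.Injective e) {y : Fin n → ℝ}
    (hy : ∀ i, i ∉ Set.range e → y i = 0) (a : Fin l) :
    (M.submatrix f e *ᵥ (y ∘ e)) a = (M *ᵥ y) (f a) :=
  Fintype.sum_of_injective e he _ (fun k => M (f a) k * y k)
    (fun i hi => by rw [hy i hi, mul_zero]) (fun _ => rfl)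

theorem exists_mulVec_eq_zero_of_det_submatrix {m : ℕ} {M : Matrix (Fin n) (Fin n) ℝ}
    {f e : Fin m → Fin n} (he : Function.Injective e) (h : (M.submatrix f e).det = 0) :
    ∃ y, y ≠ 0 ∧ (∀ i, i ∉ Set.range e → y i = 0) ∧ ∀ a, (M *ᵥ y) (f a) = 0 := by
  obtain ⟨x, hx, hx0⟩ := Matrix.exists_mulVec_eq_zero_iff.2 h
  have hxe : Function.extend e x 0 ∘ e = x := funext fun a => he.extend_apply x 0 a
  have hy : ∀ i, i ∉ Set.range e → Function.extend e x 0 i = 0 := fun i hi =>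
    Function.extend_apply' _ _ _ hi
  refine ⟨Function.extend e x 0, fun h0 => hx ?_, hy, fun a => ?_⟩
  · rw [← hxe, h0]; rfl
  · rw [← mulVec_submatrix M f he hy, hxe, hx0]; rfl

theorem det_submatrix_eq_zero_of_rank_lt {m l : ℕ} {M : Matrix (Fin l) (Fin l) ℝ} {f e : Fin m → Fin l}
    (h : M.rank < m) : (M.submatrix f e).det = 0 := by
  by_contra h0
  have h1 : (M.submatrix f e).rank = m := by
    rw [Matrix.rank_of_isUnit _ ((Matrix.isUnit_iff_isUnit_det _).2 (isUnit_iff_ne_zero.2 h0)),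
      Fintype.card_fin]
  have h2 : (M.submatrix f e).rank ≤ M.rank := Matrix.rank_submatrix_le M f e
  omega

end submatrix

/-! ### The rank condition and the determinants -/

section rank

variable {n : ℕ} {A : SymMat n}

theorem det_submatrix_succ_eq_detFun (A : SymMat n) (j : Fin n) :
    (A.1.submatrix (idxI' (cyc j 1)) (idxI' j)).det = detFun (Sum.inr j) A := by
  rw [← Matrix.det_transpose, Matrix.transpose_submatrix, A.2.eq]
  rfl

theorem CirculantRankCondition.detFun_eq_zero (hn : 5 ≤ n) (hA : CirculantRankCondition A)
    (i : Fin n ⊕ Fin n) : detFun i A = 0 := by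
  rcases i with j | j
  · refine det_submatrix_eq_zero_of_rank_lt (M := A.1.submatrix (idxI j) (idxI j))
      (f := Fin.castLE (by omega)) (e := Fin.castLE (by omega)) ?_
    rw [hA j]; omega
  · have h : idxI' (cyc j 1) = idxI j ∘ fun k => ⟨k.1 + 1, by omega⟩ := by
      funext k
      simp [idxI', idxI, cyc_cyc, add_comm]
    have h1 : detFun (Sum.inr j) A = ((A.1.submatrix (idxI j) (idxI j)).submatrix
        (Fin.castLE (by omega)) (fun k : Fin (n - 3) => ⟨k.1 + 1, by omega⟩)).det := by
      rw [Matrix.submatrix_submatrix, ← h]; rfl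
    rw [h1]
    exact det_submatrix_eq_zero_of_rank_lt (by rw [hA j]; omega)

/-- The index set `(j + 1, …, j + n - 4)`, the common part of `I'_j` and `I'_{j+1}`. -/
def idxMid (j : Fin n) : Fin (n - 4) → Fin n := fun k => cyc j (k + 1)

theorem idxMid_injective (j : Fin n) : Function.Injective (idxMid j) := by
  rintro ⟨a, ha⟩ ⟨b, hb⟩ h
  have := (cyc_eq_iff (j := j) (by omega) (by omega)).1 h
  exact Fin.ext (by simpa using this)

theorem mem_range_idxMid_cyc (hn : 5 ≤ n) (r i : Fin n) :
    i ∈ Set.range (idxMid (cyc r 3)) ↔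
      i ≠ r ∧ i ≠ cyc r 1 ∧ i ≠ cyc r 2 ∧ i ≠ cyc r 3 := by
  constructor
  · rintro ⟨⟨k, hk⟩, rfl⟩
    simp only [idxMid, cyc_cyc]
    have : 3 + (k + 1) < n := by omega
    rw [Ne, cyc_eq_self_iff this, Ne, cyc_eq_iff this (by omega), Ne,
      cyc_eq_iff this (by omega), Ne, cyc_eq_iff this (by omega)]
    omega
  · rintro ⟨h0, h1, h2, h3⟩
    obtain ⟨k, hk, rfl⟩ := exists_eq_cyc r i
    rw [Ne, cyc_eq_self_iff hk] at h0
    rw [Ne, cyc_eq_iff hk (by omega)] at h1 h2 h3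
    refine ⟨⟨k - 4, by omega⟩, ?_⟩
    simp only [idxMid, cyc_cyc]
    congr 1
    omega

theorem NonsingularBlocks.det_ne_zero (hn : 5 ≤ n) (hA : NonsingularBlocks A) (r : Fin n) :
    (A.1.submatrix (idxMid r) (idxMid r)).det ≠ 0 := by
  obtain ⟨r, rfl⟩ := cyc_surjective 3 r
  intro h
  obtain ⟨y, hy, hy0, hyA⟩ := exists_mulVec_eq_zero_of_det_submatrix (idxMid_injective _) h
  refine hy (hA r y (hy0 _ ?_) (hy0 _ ?_) (hy0 _ ?_) (hy0 _ ?_) fun i c0 c1 c2 c3 => ?_)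
  iterate 4 rw [mem_range_idxMid_cyc hn]; simp
  obtain ⟨a, rfl⟩ := (mem_range_idxMid_cyc hn r i).2 ⟨c0, c1, c2, c3⟩
  exact hyA a

/-- The restrictions of `w r` and `w (r + 1)` are two independent kernel vectors, bounding the rank
above; a nonsingular block of size `n - 4` bounds it below. -/
theorem MinimalCirculantZeros.circulantRankCondition (hn : 5 ≤ n) {w : Fin n → Fin n → ℝ}
    (hw : MinimalCirculantZeros A w) (hA : NonsingularBlocks A) : CirculantRankCondition A := by
  intro j
  apply le_antisymm
  · obtain ⟨r, rfl⟩ := cyc_surjective 3 j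
    simp only
    set M := A.1.submatrix (idxI (cyc r 3)) (idxI (cyc r 3)) with hM
    have hinj := idxI_injective (cyc r 3)
    have hout : ∀ i, i ∉ Set.range (idxI (cyc r 3)) → i = cyc r 1 ∨ i = cyc r 2 := by
      intro i hi
      rw [mem_range_idxI_cyc hn] at hi
      tauto
    have hmem : ∀ a, idxI (cyc r 3) a ≠ cyc r 1 ∧ idxI (cyc r 3) a ≠ cyc r 2 := fun a =>
      (mem_range_idxI_cyc hn r _).1 ⟨a, rfl⟩
    have h0 : M *ᵥ (w r ∘ idxI (cyc r 3)) = 0 := by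
      funext a
      rw [hM, mulVec_submatrix A.1 _ hinj, (hw r).2.2.1 _ (hmem a).1]
      · rfl
      · intro i hi
        exact ((hw r).2.1 i).2 (Or.inr (hout i hi))
    have h1 : M *ᵥ (w (cyc r 1) ∘ idxI (cyc r 3)) = 0 := by
      funext a
      rw [hM, mulVec_submatrix A.1 _ hinj, (hw _).2.2.1 _ (by rw [cyc_cyc]; exact (hmem a).2)]
      · rfl
      · intro i hi
        refine ((hw _).2.1 i).2 ?_
        rw [cyc_cyc, cyc_cyc]
        have := hout i hi
        tauto
    let v : Fin 2 → LinearMap.ker M.mulVecLin :=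
      ![⟨w r ∘ idxI (cyc r 3), h0⟩, ⟨w (cyc r 1) ∘ idxI (cyc r 3), h1⟩]
    have hv : LinearIndependent ℝ v := by
      rw [LinearIndependent.pair_iff]
      intro s t hst
      have hst' : ∀ a, s * w r (idxI (cyc r 3) a) + t * w (cyc r 1) (idxI (cyc r 3) a) = 0 :=
        fun a => congrFun (congrArg Subtype.val hst) a
      have e0 : ∀ i, i ≠ cyc r 1 → i ≠ cyc r 2 → s * w r i + t * w (cyc r 1) i = 0 := by
        intro i hi hi'
        obtain ⟨a, rfl⟩ := (mem_range_idxI_cyc hn r i).2 ⟨hi, hi'⟩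
        exact hst' a
      have e1 := e0 r (by simp (disch := omega) [self_eq_cyc_iff])
        (by simp (disch := omega) [self_eq_cyc_iff])
      have e2 := e0 (cyc r 3) (by simp (disch := omega) [cyc_eq_iff])
        (by simp (disch := omega) [cyc_eq_iff])
      have p1 : 0 < w (cyc r 1) r := by
        apply hw.pos <;> simp (disch := omega) [cyc_cyc, self_eq_cyc_iff]
      have p2 : 0 < w r (cyc r 3) := by
        apply hw.pos <;> simp (disch := omega) [cyc_eq_iff, cyc_eq_self_iff]
      rw [((hw r).2.1 r).2 (by simp), mul_zero, zero_add] at e1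
      rw [((hw (cyc r 1)).2.1 (cyc r 3)).2 (by simp [cyc_cyc]), mul_zero, add_zero] at e2
      exact ⟨(mul_eq_zero.1 e2).resolve_right p2.ne', (mul_eq_zero.1 e1).resolve_right p1.ne'⟩
    have h2 := hv.fintype_card_le_finrank
    have h3 := LinearMap.finrank_range_add_finrank_ker M.mulVecLin
    rw [Module.finrank_fin_fun] at h3
    rw [Fintype.card_fin] at h2
    change Module.finrank ℝ (LinearMap.range M.mulVecLin) ≤ _
    omega
  · by_contra! h
    refine hA.det_ne_zero hn j ?_
    have h1 : idxMid j = idxI j ∘ fun k => ⟨k.1 + 1, by omega⟩ := rfl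
    rw [h1, ← Matrix.submatrix_submatrix]
    exact det_submatrix_eq_zero_of_rank_lt h

/-- Each vanishing determinant has a kernel vector, which the nonsingular blocks identify with a
multiple of `w r`. The principal determinant yields the equation in row `r + 3`, the transposed
off-diagonal one row `r`, and the off-diagonal one of the preceding index row `r + 2`. -/
theorem mulVec_eq_zero_of_detFun (hn : 5 ≤ n) (hA : NonsingularBlocks A)
    (hdet : ∀ i, detFun i A = 0) {w : Fin n → Fin n → ℝ}
    (hw : ∀ r, w r r = 0 ∧ w r (cyc r 1) = 0 ∧ w r (cyc r 2) = 0 ∧ w r (cyc r 3) = 1 ∧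
      ∀ i, i ≠ r → i ≠ cyc r 1 → i ≠ cyc r 2 → i ≠ cyc r 3 → (A.1 *ᵥ w r) i = 0)
    (r : Fin n) {i : Fin n} (hi : i ≠ cyc r 1) : (A.1 *ᵥ w r) i = 0 := by
  have key : ∀ r y, y ≠ 0 → y r = 0 → y (cyc r 1) = 0 → y (cyc r 2) = 0 →
      (∀ i, i ≠ r → i ≠ cyc r 1 → i ≠ cyc r 2 → i ≠ cyc r 3 → (A.1 *ᵥ y) i = 0) →
      ∀ i, (A.1 *ᵥ y) i = 0 → (A.1 *ᵥ w r) i = 0 := by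
    intro r y hy h0 h1 h2 hyA i hi
    obtain ⟨w0, w1, w2, w3, hwA⟩ := hw r
    have h3 : y - y (cyc r 3) • w r = 0 := by
      refine hA r _ (by simp [h0, w0]) (by simp [h1, w1]) (by simp [h2, w2]) (by simp [w3]) ?_
      intro i c0 c1 c2 c3
      rw [Matrix.mulVec_sub, Matrix.mulVec_smul, Pi.sub_apply, Pi.smul_apply,
        hyA i c0 c1 c2 c3, hwA i c0 c1 c2 c3]
      simp
    rw [sub_eq_zero] at h3
    rw [h3, Matrix.mulVec_smul, Pi.smul_apply, smul_eq_zero] at hi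
    refine hi.resolve_left fun h4 => hy ?_
    rw [h3, h4, zero_smul]
  have hout : ∀ (r : Fin n) (y : Fin n → ℝ), (∀ i, i ∉ Set.range (idxI' (cyc r 3)) → y i = 0) →
      y r = 0 ∧ y (cyc r 1) = 0 ∧ y (cyc r 2) = 0 := by
    intro r y h
    refine ⟨h _ ?_, h _ ?_, h _ ?_⟩ <;> rw [mem_range_idxI'_cyc hn] <;> simp
  have step1 : ∀ r i, i ≠ r → i ≠ cyc r 1 → i ≠ cyc r 2 → (A.1 *ᵥ w r) i = 0 := by
    intro r i hi0 hi1 hi2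
    obtain ⟨y, hy, hy0, hyA⟩ := exists_mulVec_eq_zero_of_det_submatrix
      (idxI'_injective (cyc r 3)) (hdet (Sum.inl (cyc r 3)))
    obtain ⟨h0, h1, h2⟩ := hout r y hy0
    have hyA' : ∀ i, i ≠ r → i ≠ cyc r 1 → i ≠ cyc r 2 → (A.1 *ᵥ y) i = 0 := by
      intro i c0 c1 c2
      obtain ⟨a, rfl⟩ := (mem_range_idxI'_cyc hn r i).2 ⟨c0, c1, c2⟩
      exact hyA a
    exact key r y hy h0 h1 h2 (fun i c0 c1 c2 _ => hyA' i c0 c1 c2) i (hyA' i hi0 hi1 hi2)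
  by_cases hir : i = r
  · subst hir
    obtain ⟨y, hy, hy0, hyA⟩ := exists_mulVec_eq_zero_of_det_submatrix
      (idxI'_injective (cyc i 3)) ((det_submatrix_succ_eq_detFun A (cyc i 3)).trans (hdet _))
    obtain ⟨h0, h1, h2⟩ := hout i y hy0
    have hyA' : ∀ k, k ≠ cyc i 1 → k ≠ cyc i 2 → k ≠ cyc i 3 → (A.1 *ᵥ y) k = 0 := by
      intro k c1 c2 c3
      obtain ⟨a, rfl⟩ := (mem_range_idxI'_cyc hn (cyc i 1) k).2
        ⟨c1, by rwa [cyc_cyc], by rwa [cyc_cyc]⟩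
      rw [cyc_cyc] at hyA
      simpa [cyc_cyc] using hyA a
    refine key i y hy h0 h1 h2 (fun k _ c1 c2 c3 => hyA' k c1 c2 c3) i (hyA' i ?_ ?_ ?_) <;>
      simp (disch := omega) [self_eq_cyc_iff]
  by_cases hir2 : i = cyc r 2
  · subst hir2
    obtain ⟨s, rfl⟩ := cyc_surjective 1 r
    simp only [cyc_cyc] at *
    have h := hdet (Sum.inr (cyc s 3))
    obtain ⟨y, hy, hy0, hyA⟩ := exists_mulVec_eq_zero_of_det_submatrix
      (idxI'_injective (cyc (cyc s 3) 1)) h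
    obtain ⟨h1, h2, h3⟩ := hout (cyc s 1) y (by simpa [cyc_cyc] using hy0)
    simp only [cyc_cyc] at h2 h3
    have hyA' : ∀ k, k ≠ s → k ≠ cyc s 1 → k ≠ cyc s 2 → (A.1 *ᵥ y) k = 0 := by
      intro k c0 c1 c2
      obtain ⟨a, rfl⟩ := (mem_range_idxI'_cyc hn s k).2 ⟨c0, c1, c2⟩
      exact hyA a
    obtain ⟨w1, w2, w3, w4, -⟩ := hw (cyc s 1)
    simp only [cyc_cyc] at w2 w3 w4
    have hwA : ∀ k, k ≠ cyc s 1 → k ≠ cyc s 2 → k ≠ cyc s 3 →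
        (A.1 *ᵥ w (cyc s 1)) k = 0 := by
      simpa [cyc_cyc] using step1 (cyc s 1)
    have hws : w (cyc s 1) s ≠ 0 := by
      intro h5
      have h6 := hA s _ h5 w1 w2 w3 fun k _ c1 c2 c3 => hwA k c1 c2 c3
      rw [h6] at w4
      simp at w4
    -- The equation for `y` in row `s` is not available, so `key` does not apply. Instead the
    -- combination vanishing at `s` is tested against the block omitting `{s, …, s + 3}`.
    have hcomb : w (cyc s 1) s • y - y s • w (cyc s 1) = 0 := by
      refine hA s _ (by simp [mul_comm]) (by simp [h1, w1]) (by simp [h2, w2])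
        (by simp [h3, w3]) ?_
      intro k c0 c1 c2 c3
      rw [Matrix.mulVec_sub, Matrix.mulVec_smul, Matrix.mulVec_smul, Pi.sub_apply, Pi.smul_apply,
        Pi.smul_apply, hyA' k c0 c1 c2, hwA k c1 c2 c3]
      simp
    rw [sub_eq_zero] at hcomb
    have hys : y s ≠ 0 := by
      intro h5
      rw [h5, zero_smul] at hcomb
      exact hy ((smul_eq_zero.1 hcomb).resolve_left hws)
    have h7 := congrFun (congrArg (fun x => A.1 *ᵥ x) hcomb) (cyc s 3)
    simp only [Matrix.mulVec_smul, Pi.smul_apply, smul_eq_mul] at h7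
    rw [hyA' (cyc s 3) (by simp (disch := omega) [cyc_eq_self_iff])
      (by simp (disch := omega) [cyc_eq_iff]) (by simp (disch := omega) [cyc_eq_iff]),
      mul_zero] at h7
    exact (mul_eq_zero.1 h7.symm).resolve_left hys
  exact step1 r i hir hi hir2

end rank

/-! ### Perturbation -/

section perturbation

open Topology Filter

variable {n : ℕ}

/-- The rows of `A` with indices outside `{r, r + 1, r + 2, r + 3}`, with the columns `r`, `r + 1`,
`r + 2` deleted, completed to a square matrix by rows of the identity matrix. -/
def maskMatrix (A : SymMat n) (r : Fin n) : Matrix (Fin n) (Fin n) ℝ :=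
  Matrix.of fun i k =>
    if i = r ∨ i = cyc r 1 ∨ i = cyc r 2 ∨ i = cyc r 3 then (if i = k then 1 else 0)
    else if k = r ∨ k = cyc r 1 ∨ k = cyc r 2 then 0 else A.1 i k

theorem maskMatrix_mulVec_of_mem (A : SymMat n) {r i : Fin n}
    (hi : i = r ∨ i = cyc r 1 ∨ i = cyc r 2 ∨ i = cyc r 3) (y : Fin n → ℝ) :
    (maskMatrix A r *ᵥ y) i = y i := by
  rw [mulVec_apply_eq_sum]
  simp only [maskMatrix, Matrix.of_apply, if_pos hi]
  simp

theorem maskMatrix_mulVec_of_not_mem (A : SymMat n) {r i : Fin n}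
    (hi : ¬(i = r ∨ i = cyc r 1 ∨ i = cyc r 2 ∨ i = cyc r 3)) {y : Fin n → ℝ}
    (h0 : y r = 0) (h1 : y (cyc r 1) = 0) (h2 : y (cyc r 2) = 0) :
    (maskMatrix A r *ᵥ y) i = (A.1 *ᵥ y) i := by
  rw [mulVec_apply_eq_sum, mulVec_apply_eq_sum]
  refine Finset.sum_congr rfl fun k _ => ?_
  simp only [maskMatrix, Matrix.of_apply, if_neg hi]
  split_ifs with hk
  · rcases hk with rfl | rfl | rfl <;> simp [*]
  · rfl

theorem nonsingularBlocks_iff {A : SymMat n} :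
    NonsingularBlocks A ↔ ∀ r, (maskMatrix A r).det ≠ 0 := by
  constructor
  · intro hA r h
    obtain ⟨y, hy, hy0⟩ := Matrix.exists_mulVec_eq_zero_iff.2 h
    have hmem : ∀ i, (i = r ∨ i = cyc r 1 ∨ i = cyc r 2 ∨ i = cyc r 3) → y i = 0 := by
      intro i hi
      rw [← maskMatrix_mulVec_of_mem A hi y, hy0]; rfl
    have h0 := hmem r (by simp)
    have h1 := hmem (cyc r 1) (by simp)
    have h2 := hmem (cyc r 2) (by simp)
    have h3 := hmem (cyc r 3) (by simp)
    refine hy (hA r y h0 h1 h2 h3 fun i c0 c1 c2 c3 => ?_)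
    rw [← maskMatrix_mulVec_of_not_mem A (by tauto) h0 h1 h2, hy0]; rfl
  · intro hA r y h0 h1 h2 h3 hy
    by_contra hne
    refine hA r (Matrix.exists_mulVec_eq_zero_iff.1 ⟨y, hne, ?_⟩)
    funext i
    by_cases hi : i = r ∨ i = cyc r 1 ∨ i = cyc r 2 ∨ i = cyc r 3
    · rw [maskMatrix_mulVec_of_mem A hi]
      rcases hi with rfl | rfl | rfl | rfl <;> assumption
    · rw [maskMatrix_mulVec_of_not_mem A hi h0 h1 h2]
      exact hy i (by tauto) (by tauto) (by tauto) (by tauto)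

/-- The solution of the linear system with matrix `maskMatrix A r` and right-hand side the unit
vector with index `r + 3`. -/
noncomputable def candidateZero (A : SymMat n) (r : Fin n) : Fin n → ℝ :=
  (maskMatrix A r).det⁻¹ • ((maskMatrix A r).adjugate *ᵥ Pi.single (cyc r 3) 1)

theorem candidateZero_spec (hn : 5 ≤ n) {A : SymMat n} (hA : NonsingularBlocks A) (r : Fin n) :
    candidateZero A r r = 0 ∧ candidateZero A r (cyc r 1) = 0 ∧
      candidateZero A r (cyc r 2) = 0 ∧ candidateZero A r (cyc r 3) = 1 ∧
      ∀ i, i ≠ r → i ≠ cyc r 1 → i ≠ cyc r 2 → i ≠ cyc r 3 →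
        (A.1 *ᵥ candidateZero A r) i = 0 := by
  have hT : maskMatrix A r *ᵥ candidateZero A r = Pi.single (cyc r 3) 1 := by
    rw [candidateZero, Matrix.mulVec_smul, Matrix.mulVec_mulVec, Matrix.mul_adjugate,
      Matrix.smul_mulVec, Matrix.one_mulVec, inv_smul_smul₀ (nonsingularBlocks_iff.1 hA r)]
  have hmem : ∀ i, (i = r ∨ i = cyc r 1 ∨ i = cyc r 2 ∨ i = cyc r 3) →
      candidateZero A r i = (Pi.single (cyc r 3) 1 : Fin n → ℝ) i := by
    intro i hi
    rw [← maskMatrix_mulVec_of_mem A hi (candidateZero A r), hT]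
  have h0 := hmem r (by simp)
  have h1 := hmem (cyc r 1) (by simp)
  have h2 := hmem (cyc r 2) (by simp)
  have h3 := hmem (cyc r 3) (by simp)
  rw [Pi.single_eq_of_ne (by simp (disch := omega) [cyc_eq_iff, self_eq_cyc_iff])] at h0 h1 h2
  rw [Pi.single_eq_same] at h3
  refine ⟨h0, h1, h2, h3, fun i c0 c1 c2 c3 => ?_⟩
  rw [← maskMatrix_mulVec_of_not_mem A (by tauto) h0 h1 h2, hT, Pi.single_eq_of_ne c3]

theorem continuous_maskMatrix (r : Fin n) : Continuous fun A : SymMat n => maskMatrix A r := by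
  refine continuous_matrix fun i k => ?_
  simp only [maskMatrix, Matrix.of_apply]
  split_ifs
  · exact continuous_const
  · exact continuous_const
  · exact continuous_const
  · exact (continuous_apply_apply i k).comp continuous_subtype_val

theorem continuousAt_candidateZero {A : SymMat n} (hA : NonsingularBlocks A) (r : Fin n) :
    ContinuousAt (fun B => candidateZero B r) A := by
  have h1 := (continuous_maskMatrix r).matrix_det.continuousAt (x := A)
  have h2 := ((continuous_maskMatrix r).matrix_adjugate.matrix_mulVec
    (continuous_const (y := (Pi.single (cyc r 3) 1 : Fin n → ℝ)))).continuousAt (x := A)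
  exact (h1.inv₀ (nonsingularBlocks_iff.1 hA r)).smul h2

theorem eventually_nonsingularBlocks {A : SymMat n} (hA : NonsingularBlocks A) :
    ∀ᶠ B in 𝓝 A, NonsingularBlocks B := by
  simp only [nonsingularBlocks_iff, eventually_all]
  exact fun r => (continuous_maskMatrix r).matrix_det.continuousAt.eventually_ne
    (nonsingularBlocks_iff.1 hA r)

theorem continuous_mulVec : Continuous fun p : SymMat n × (Fin n → ℝ) => p.1.1 *ᵥ p.2 :=
  (continuous_subtype_val.comp continuous_fst).matrix_mulVec continuous_snd

/-- At `A` itself the candidate is a positive multiple of `w r`, and it depends continuously on the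
matrix. -/
theorem eventually_candidateZero_pos (hn : 5 ≤ n) {A : SymMat n} {w : Fin n → Fin n → ℝ}
    (hw : MinimalCirculantZeros A w) (hA : NonsingularBlocks A) :
    ∀ᶠ B in 𝓝 A, ∀ r, (∀ i, i ≠ r → i ≠ cyc r 1 → i ≠ cyc r 2 → 0 < candidateZero B r i) ∧
      0 < (B.1 *ᵥ candidateZero B r) (cyc r 1) := by
  rw [eventually_all]
  intro r
  obtain ⟨h0, h1, h2, h3, h4⟩ := candidateZero_spec hn hA r
  obtain ⟨c, hc⟩ := hw.eq_smul hn hA h0 h1 h2 h4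
  have hcpos : 0 < c := by
    have h5 : 0 ≤ w r (cyc r 3) := (hw r).1 _
    rw [hc, Pi.smul_apply, smul_eq_mul] at h3
    by_contra! h6
    nlinarith
  refine Filter.Eventually.and ?_ ?_
  · rw [eventually_all]
    intro i
    simp only [eventually_imp_distrib_left]
    intro c0 c1 c2
    have h5 : ContinuousAt (fun B => candidateZero B r i) A :=
      (continuous_apply i).continuousAt.comp (continuousAt_candidateZero hA r)
    have h6 : 0 < candidateZero A r i := by
      rw [hc]
      exact mul_pos hcpos (hw.pos c0 c1 c2)
    exact h5.eventually (lt_mem_nhds h6)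
  · have h5 : ContinuousAt (fun B : SymMat n => (B.1 *ᵥ candidateZero B r) (cyc r 1)) A :=
      ((continuous_apply (cyc r 1)).comp continuous_mulVec).continuousAt.comp
        (continuousAt_id.prodMk (continuousAt_candidateZero hA r))
    have h6 : 0 < (A.1 *ᵥ candidateZero A r) (cyc r 1) := by
      rw [hc, Matrix.mulVec_smul]
      exact mul_pos hcpos (hw r).2.2.2
    exact h5.eventually (lt_mem_nhds h6)

/-! ### Persistence of copositivity under perturbation. -/

theorem continuous_bil : Continuous fun p : SymMat n × (Fin n → ℝ) => bil p.1 p.2 p.2 :=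
  continuous_snd.dotProduct continuous_mulVec

/-- The nonnegative vectors of sum one whose support contains none of the sets
`{1, …, n} \ {r, r + 1, r + 2}`. -/
def smallSupportSimplex (n : ℕ) : Set (Fin n → ℝ) :=
  stdSimplex ℝ (Fin n) ∩
    ⋂ r : Fin n, ⋃ i : {i : Fin n // i ≠ r ∧ i ≠ cyc r 1 ∧ i ≠ cyc r 2}, {x | x i.1 = 0}

theorem isCompact_smallSupportSimplex : IsCompact (smallSupportSimplex n) :=
  (isCompact_stdSimplex ℝ (Fin n)).inter_right (isClosed_iInter fun _ =>
    isClosed_iUnion_of_finite fun i => isClosed_eq (continuous_apply i.1) continuous_const)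

/-- By the classification, the support of every zero of `A` contains the complement of some `{r, r +
1, r + 2}`. So `A` has no zeros on this compact set, and strict positivity there is an open
condition. -/
theorem eventually_pos_on_smallSupportSimplex (hn : 5 ≤ n) {A : SymMat n} (hA : IsExceptional A)
    {u : Fin n → Fin n → ℝ} (hu : CirculantZeros A u) :
    ∀ᶠ B in 𝓝 A, ∀ x ∈ smallSupportSimplex n, 0 < bil B x x := by
  refine isCompact_smallSupportSimplex.eventually_forall_of_forall_eventually fun x hx => ?_
  refine continuous_bil.continuousAt.eventually (lt_mem_nhds ?_)
  obtain ⟨⟨hx0, hx1⟩, hx2⟩ := hx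
  refine lt_of_le_of_ne (hA.1.bil_nonneg hx0) fun h => ?_
  have hz : IsCopZero A x := ⟨by rintro rfl; simp at hx1, hx0, h.symm⟩
  obtain ⟨r, hr⟩ := exists_zero_pattern hn hA hu hz
  obtain ⟨⟨i, hi0, hi1, hi2⟩, hxi⟩ := Set.mem_iUnion.1 (Set.mem_iInter.1 hx2 r)
  rcases hr with hr | hr
  · rcases (hr i).1 hxi with h | h <;> contradiction
  · rcases (hr i).1 hxi with h | h | h <;> contradiction

/-- Induction on the size of the support. If it contains that of some `w r`, subtracting `c • w r`
up to the boundary of the orthant shrinks it and lowers the form by `2 c x_{r+1} (A w_r)_{r+1} ≥ 0`.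
Otherwise `x` is zero or can be scaled into the compact set. -/
theorem MinimalCirculantZeros.isCopositive {A : SymMat n} {w : Fin n → Fin n → ℝ}
    (hw : MinimalCirculantZeros A w) (hA : ∀ x ∈ smallSupportSimplex n, 0 < bil A x x) :
    IsCopositive A := by
  classical
  suffices h : ∀ m, ∀ x : Fin n → ℝ, 0 ≤ x → (Finset.univ.filter fun i => x i ≠ 0).card = m →
      0 ≤ bil A x x from fun x hx => h _ x hx rfl
  intro m
  induction m using Nat.strong_induction_on with
  | _ m ih =>
    intro x hx hm
    by_cases hr : ∃ r, ∀ i, i ≠ r → i ≠ cyc r 1 → i ≠ cyc r 2 → x i ≠ 0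
    · obtain ⟨r, hr⟩ := hr
      have hsub : ∀ i, w r i ≠ 0 → x i ≠ 0 := by
        intro i hi
        rw [Ne, (hw r).2.1] at hi
        exact hr i (by tauto) (by tauto) (by tauto)
      obtain ⟨c, hc, hcx, i, hi, hi0⟩ := exists_min_ratio hx (hw r).1 (hw.ne_zero r)
        fun i hi => lt_of_le_of_ne (hx i) (hsub i hi.ne').symm
      have hlt : (Finset.univ.filter fun i => (x - c • w r) i ≠ 0).card < m := by
        rw [← hm]
        refine Finset.card_lt_card (Finset.ssubset_iff_subset_ne.2 ⟨fun k hk => ?_, fun h => ?_⟩)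
        · simp only [Finset.mem_filter, Finset.mem_univ, true_and] at hk ⊢
          intro h0
          have h1 : w r k = 0 := by
            by_contra h2
            exact hsub k h2 h0
          exact hk (by simp [h0, h1])
        · have h1 : i ∈ Finset.univ.filter fun i => x i ≠ 0 := by
            simpa using hsub i hi.ne'
          rw [← h] at h1
          simp only [Finset.mem_filter, Finset.mem_univ, true_and] at h1
          exact h1 hi0
      have h1 := ih _ hlt _ hcx rfl
      rw [bil_sub_smul_self, hw.bil_self, hw.bil_eq] at h1
      have h2 : 0 ≤ c * (x (cyc r 1) * (A.1 *ᵥ w r) (cyc r 1)) :=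
        mul_nonneg hc.le (mul_nonneg (hx _) (hw r).2.2.2.le)
      linarith
    · push Not at hr
      by_cases hx0 : x = 0
      · simp [hx0, bil]
      have hs : 0 < ∑ i, x i := by
        refine lt_of_le_of_ne (Finset.sum_nonneg fun i _ => hx i) fun h => hx0 ?_
        funext i
        exact (Finset.sum_eq_zero_iff_of_nonneg (fun i _ => hx i)).1 h.symm i (Finset.mem_univ i)
      have h1 := hA ((∑ i, x i)⁻¹ • x) ⟨⟨fun i => mul_nonneg (inv_nonneg.2 hs.le) (hx i), ?_⟩, ?_⟩
      · rw [bil_smul_left, bil_smul_right] at h1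
        have h2 : 0 < (∑ i, x i)⁻¹ := inv_pos.2 hs
        exact (pos_of_mul_pos_right (pos_of_mul_pos_right h1 h2.le) h2.le).le
      · simp only [Pi.smul_apply, smul_eq_mul, ← Finset.mul_sum]
        exact inv_mul_cancel₀ hs.ne'
      · refine Set.mem_iInter.2 fun r => ?_
        obtain ⟨i, h0, h1, h2, h3⟩ := hr r
        exact Set.mem_iUnion.2 ⟨⟨i, h0, h1, h2⟩, by simp [h3]⟩

theorem eventually_minimalCirculantZeros (hn : 5 ≤ n) {A : SymMat n} (hA : IsExceptional A)
    {u w : Fin n → Fin n → ℝ} (hu : CirculantZeros A u) (hw : MinimalCirculantZeros A w) :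
    ∀ᶠ B in 𝓝 A, NonsingularBlocks B ∧ ((∀ i, detFun i B = 0) →
      ∃ w', MinimalCirculantZeros B w' ∧ IsCopositive B) := by
  have hND := nonsingularBlocks_of_exceptional hn hA hu hw
  filter_upwards [eventually_nonsingularBlocks hND, eventually_candidateZero_pos hn hw hND,
    eventually_pos_on_smallSupportSimplex hn hA hu] with B h1 h2 h3
  refine ⟨h1, fun hdet => ?_⟩
  have h4 : MinimalCirculantZeros B (candidateZero B) := by
    intro r
    obtain ⟨c0, c1, c2, -, -⟩ := candidateZero_spec hn h1 r
    have hiff : ∀ i, candidateZero B r i = 0 ↔ i = r ∨ i = cyc r 1 ∨ i = cyc r 2 := by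
      intro i
      constructor
      · intro hi
        by_contra! hcon
        exact ((h2 r).1 i hcon.1 hcon.2.1 hcon.2.2).ne' hi
      · rintro (rfl | rfl | rfl) <;> assumption
    refine ⟨fun i => ?_, hiff, fun i hi => mulVec_eq_zero_of_detFun hn h1 hdet
      (candidateZero_spec hn h1) r hi, (h2 r).2⟩
    by_cases hi : candidateZero B r i = 0
    · exact hi.symm.le
    · rw [hiff] at hi
      exact ((h2 r).1 i (by tauto) (by tauto) (by tauto)).le
  exact ⟨_, h4, h4.isCopositive h3⟩

end perturbation

/-! ### Gradients of the determinants -/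

section gradient

/-- A nonzero cofactor makes both kernels one-dimensional; the columns of the adjugate lie in the
right kernel and its rows in the left one. -/
theorem adjugate_eq_of_kernel {ι : Type*} [Fintype ι] [DecidableEq ι] {M : Matrix ι ι ℝ}
    {x y : ι → ℝ} (hx : M *ᵥ x = 0) (hy : y ᵥ* M = 0) (hx0 : x ≠ 0) (hy0 : y ≠ 0) {k i : ι}
    (h : M.adjugate k i ≠ 0) : ∃ g : ℝ, g ≠ 0 ∧ ∀ a b, M.adjugate a b = g * x a * y b := by
  have hdet : M.det = 0 := Matrix.exists_mulVec_eq_zero_iff.1 ⟨x, hx0, hx⟩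
  rw [Matrix.adjugate_apply] at h
  have hright : ∀ z : ι → ℝ, M *ᵥ z = 0 → z k = 0 → z = 0 := by
    intro z hz hzk
    by_contra hne
    refine h (Matrix.exists_mulVec_eq_zero_iff.1 ⟨z, hne, ?_⟩)
    funext a
    by_cases ha : a = i
    · subst ha
      simp [Matrix.mulVec, hzk]
    · rw [Matrix.mulVec, Matrix.updateRow_ne ha]
      exact congrFun hz a
  have hleft : ∀ z : ι → ℝ, z ᵥ* M = 0 → z i = 0 → z = 0 := by
    intro z hz hzi
    by_contra hne
    refine h (Matrix.exists_vecMul_eq_zero_iff.1 ⟨z, hne, ?_⟩)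
    funext b
    rw [← hz]
    refine Finset.sum_congr rfl fun a _ => ?_
    change z a * M.updateRow i (Pi.single k 1) a b = z a * M a b
    by_cases ha : a = i
    · subst ha
      rw [hzi, zero_mul, zero_mul]
    · rw [Matrix.updateRow_ne ha]
  have hxk : x k ≠ 0 := fun h0 => hx0 (hright x hx h0)
  have hyi : y i ≠ 0 := fun h0 => hy0 (hleft y hy h0)
  rw [← Matrix.adjugate_apply] at h
  have hcol : ∀ a b, M.adjugate a b = M.adjugate k b / x k * x a := by
    intro a b
    have h1 : M *ᵥ (fun c => M.adjugate c b) = 0 := by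
      funext c
      change (M * M.adjugate) c b = 0
      rw [M.mul_adjugate, hdet, zero_smul]; rfl
    have h2 := hright ((fun c => M.adjugate c b) - (M.adjugate k b / x k) • x)
      (by rw [Matrix.mulVec_sub, Matrix.mulVec_smul, h1, hx]; simp)
      (by simp [div_mul_cancel₀ _ hxk])
    exact sub_eq_zero.1 (congrFun h2 a)
  have hrow : ∀ b, M.adjugate k b = M.adjugate k i / y i * y b := by
    intro b
    have h1 : M.adjugate k ᵥ* M = 0 := by
      funext c
      change (M.adjugate * M) k c = 0
      rw [M.adjugate_mul, hdet, zero_smul]; rfl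
    have h2 := hleft (M.adjugate k - (M.adjugate k i / y i) • y)
      (by rw [Matrix.sub_vecMul, Matrix.smul_vecMul, h1, hy]; simp)
      (by simp [div_mul_cancel₀ _ hyi])
    exact sub_eq_zero.1 (congrFun h2 b)
  refine ⟨M.adjugate k i / (x k * y i), div_ne_zero h (mul_ne_zero hxk hyi), fun a b => ?_⟩
  rw [hcol, hrow]
  field_simp

/-- The determinant as a continuous multilinear function of the rows. -/
noncomputable def detMultilinear (m : ℕ) :
    ContinuousMultilinearMap ℝ (fun _ : Fin m => Fin m → ℝ) ℝ where
  toMultilinearMap := Matrix.detRowAlternating.toMultilinearMap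
  cont := (continuous_id (X := Matrix (Fin m) (Fin m) ℝ)).matrix_det

theorem detMultilinear_linearDeriv {m : ℕ} (M N : Matrix (Fin m) (Fin m) ℝ) :
    (detMultilinear m).linearDeriv M N = ∑ i, ∑ k, M.adjugate k i * N i k := by
  refine (ContinuousMultilinearMap.linearDeriv_apply _ _ _).trans ?_
  refine Finset.sum_congr rfl fun i _ => ?_
  change (M.updateRow i (N i)).det = _
  rw [← Matrix.cramer_transpose_apply, Matrix.cramer_eq_adjugate_mulVec,
    ← Matrix.adjugate_transpose]
  rfl

variable {n : ℕ}

/-- The submatrix as a continuous linear function of the symmetric matrix. -/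
noncomputable def submatrixCLM {m : ℕ} (f e : Fin m → Fin n) :
    SymMat n →L[ℝ] (Fin m → Fin m → ℝ) :=
  LinearMap.toContinuousLinearMap
    { toFun := fun X i k => X.1 (f i) (e k)
      map_add' := fun _ _ => rfl
      map_smul' := fun _ _ => rfl }

theorem contDiff_det_submatrix {m : ℕ} (f e : Fin m → Fin n) :
    ContDiff ℝ ∞ fun X : SymMat n => (X.1.submatrix f e).det :=
  (detMultilinear m).contDiff.comp (submatrixCLM f e).contDiff

theorem contDiff_detFun (i : Fin n ⊕ Fin n) : ContDiff ℝ ∞ (detFun i) := by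
  rcases i with j | j <;> exact contDiff_det_submatrix _ _

/-- Jacobi's formula for the derivative of a determinant, combined with the rank-one form of the
adjugate. The hypothesis `hker` says that deleting row `i` and column `k` leaves a nonsingular
matrix. -/
theorem fderiv_det_submatrix {m : ℕ} {f e : Fin m → Fin n} (hf : Function.Injective f)
    (he : Function.Injective e) {A : SymMat n} {x y : Fin n → ℝ}
    (hx : ∀ i, i ∉ Set.range e → x i = 0) (hy : ∀ i, i ∉ Set.range f → y i = 0)
    (hx0 : x ≠ 0) (hy0 : y ≠ 0) (hAx : ∀ a, (A.1 *ᵥ x) (f a) = 0)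
    (hAy : ∀ a, (A.1 *ᵥ y) (e a) = 0) (k i : Fin m)
    (hker : ∀ z : Fin n → ℝ, (∀ i, i ∉ Set.range e → z i = 0) → z (e k) = 0 →
      (∀ a, a ≠ i → (A.1 *ᵥ z) (f a) = 0) → z = 0) :
    ∃ g : ℝ, g ≠ 0 ∧ ∀ H, fderiv ℝ (fun X : SymMat n => (X.1.submatrix f e).det) A H
      = g * bil H y x := by
  have hcomp : ∀ {e : Fin m → Fin n} {x : Fin n → ℝ}, (∀ i, i ∉ Set.range e → x i = 0) →
      x ≠ 0 → x ∘ e ≠ 0 := by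
    intro e x hx hx0 h
    apply hx0
    funext l
    by_cases hl : l ∈ Set.range e
    · obtain ⟨a, rfl⟩ := hl
      exact congrFun h a
    · exact hx l hl
  set M := A.1.submatrix f e with hM
  have hMx : M *ᵥ (x ∘ e) = 0 := by
    funext a
    rw [hM, mulVec_submatrix A.1 f he hx, hAx]; rfl
  have hMy : (y ∘ f) ᵥ* M = 0 := by
    rw [← Matrix.mulVec_transpose, hM, Matrix.transpose_submatrix, A.2.eq]
    funext a
    rw [mulVec_submatrix A.1 e hf hy, hAy]; rfl
  have hadj : M.adjugate k i ≠ 0 := by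
    rw [Matrix.adjugate_apply]
    intro h
    obtain ⟨v, hv, hv0⟩ := Matrix.exists_mulVec_eq_zero_iff.2 h
    have hve : Function.extend e v 0 ∘ e = v := funext fun a => he.extend_apply v 0 a
    have hvr : ∀ i, i ∉ Set.range e → Function.extend e v 0 i = 0 := fun i hi =>
      Function.extend_apply' _ _ _ hi
    have hz := hker (Function.extend e v 0) hvr ?_ ?_
    · apply hv
      rw [← hve, hz]; rfl
    · rw [he.extend_apply]
      have := congrFun hv0 i
      simpa [Matrix.mulVec] using this
    · intro a ha
      rw [← mulVec_submatrix A.1 f he hvr, hve]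
      have := congrFun hv0 a
      rwa [Matrix.mulVec, Matrix.updateRow_ne ha] at this
  obtain ⟨g, hg, hgM⟩ := adjugate_eq_of_kernel hMx hMy (hcomp hx hx0) (hcomp hy hy0) hadj
  refine ⟨g, hg, fun H => ?_⟩
  have hder : HasFDerivAt (fun X : SymMat n => (X.1.submatrix f e).det)
      (((detMultilinear m).linearDeriv M).comp (submatrixCLM f e)) A :=
    ((detMultilinear m).hasFDerivAt (submatrixCLM f e A)).comp A (submatrixCLM f e).hasFDerivAt
  rw [hder.fderiv]
  change (detMultilinear m).linearDeriv M (H.1.submatrix f e) = _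
  rw [detMultilinear_linearDeriv]
  have h1 : bil H y x = ∑ a, y (f a) * ∑ b, H.1 (f a) (e b) * x (e b) := by
    rw [bil_eq_sum]
    refine (Fintype.sum_of_injective f hf _ _ (fun i hi => ?_) fun a => ?_).symm
    · rw [hy i hi, zero_mul]
    · rw [← mulVec_submatrix H.1 f he hx]; rfl
  rw [h1, Finset.mul_sum]
  refine Finset.sum_congr rfl fun a _ => ?_
  rw [Finset.mul_sum, Finset.mul_sum]
  refine Finset.sum_congr rfl fun b _ => ?_
  rw [hgM]
  simp only [Function.comp_apply, Matrix.submatrix_apply]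
  ring

variable {A : SymMat n} {w : Fin n → Fin n → ℝ}

theorem fderiv_detFun_inl (hn : 5 ≤ n) (hw : MinimalCirculantZeros A w)
    (hA : NonsingularBlocks A) (r : Fin n) :
    ∃ g : ℝ, g ≠ 0 ∧ ∀ H, fderiv ℝ (detFun (Sum.inl (cyc r 3))) A H
      = g * bil H (w r) (w r) := by
  have hsupp : ∀ i, i ∉ Set.range (idxI' (cyc r 3)) → w r i = 0 := by
    intro i hi
    rw [mem_range_idxI'_cyc hn] at hi
    rw [(hw r).2.1]
    tauto
  have hAw : ∀ a, (A.1 *ᵥ w r) (idxI' (cyc r 3) a) = 0 := fun a =>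
    (hw r).2.2.1 _ ((mem_range_idxI'_cyc hn r _).1 ⟨a, rfl⟩).2.1
  have hinj := idxI'_injective (cyc r 3)
  refine fderiv_det_submatrix hinj hinj hsupp hsupp (hw.ne_zero r) (hw.ne_zero r) hAw hAw
    ⟨0, by omega⟩ ⟨0, by omega⟩ fun z hz hz3 hAz => ?_
  have h3 : idxI' (cyc r 3) ⟨0, by omega⟩ = cyc r 3 := by simp [idxI', cyc_zero]
  rw [h3] at hz3
  refine hA r z (hz _ ?_) (hz _ ?_) (hz _ ?_) hz3 fun i c0 c1 c2 c3 => ?_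
  iterate 3 rw [mem_range_idxI'_cyc hn]; simp
  obtain ⟨a, rfl⟩ := (mem_range_idxI'_cyc hn r i).2 ⟨c0, c1, c2⟩
  exact hAz a fun h => c3 (by rw [h, h3])

/-- Deleting the first row, of index `r + 3`, and the last column, which is `r` after wrapping
around, leaves the nonsingular block omitting `{r, …, r + 3}`. -/
theorem fderiv_detFun_inr (hn : 5 ≤ n) (hw : MinimalCirculantZeros A w)
    (hA : NonsingularBlocks A) (r : Fin n) :
    ∃ g : ℝ, g ≠ 0 ∧ ∀ H, fderiv ℝ (detFun (Sum.inr (cyc r 3))) A H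
      = g * bil H (w r) (w (cyc r 1)) := by
  have hsupp : ∀ r i, i ∉ Set.range (idxI' (cyc r 3)) → w r i = 0 := by
    intro r i hi
    rw [mem_range_idxI'_cyc hn] at hi
    rw [(hw r).2.1]
    tauto
  have hcomm : cyc (cyc r 3) 1 = cyc (cyc r 1) 3 := by rw [cyc_cyc, cyc_cyc]
  have hrange : ∀ a, idxI' (cyc (cyc r 3) 1) a ≠ cyc r 1 := fun a => by
    rw [hcomm]
    exact ((mem_range_idxI'_cyc hn (cyc r 1) _).1 ⟨a, rfl⟩).1
  refine fderiv_det_submatrix (idxI'_injective _) (idxI'_injective _)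
    (by rw [hcomm]; exact hsupp _) (hsupp r) (hw.ne_zero _) (hw.ne_zero r) (fun a => ?_)
    (fun a => (hw r).2.2.1 _ (hrange a)) ⟨n - 4, by omega⟩ ⟨0, by omega⟩ fun z hz hz0 hAz => ?_
  · refine (hw _).2.2.1 _ ?_
    rw [cyc_cyc]
    exact ((mem_range_idxI'_cyc hn r _).1 ⟨a, rfl⟩).2.2
  · have h0 : idxI' (cyc (cyc r 3) 1) ⟨n - 4, by omega⟩ = r := by
      simp only [idxI', cyc_cyc]
      rw [show 3 + 1 + (n - 4) = 0 + n by omega, cyc_add_period, cyc_zero]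
    rw [h0] at hz0
    rw [hcomm] at hz
    refine hA r z hz0 (hz _ ?_) (hz _ ?_) (hz _ ?_) fun i c0 c1 c2 c3 => ?_
    iterate 3 rw [mem_range_idxI'_cyc hn]; simp [cyc_cyc]
    obtain ⟨a, rfl⟩ := (mem_range_idxI'_cyc hn r i).2 ⟨c0, c1, c2⟩
    refine hAz a fun h => c3 ?_
    rw [h]
    simp [idxI', cyc_zero]

theorem MinimalCirculantZeros.exists_bil_eq (hw : MinimalCirculantZeros A w)
    {K : Matrix (Fin n) (Fin n) ℝ} (hK : K.IsSymm) :
    ∃ H : SymMat n, ∀ r s, bil H (w r) (w s) = K r s := by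
  set W : Matrix (Fin n) (Fin n) ℝ := Matrix.of fun i r => w r i with hW
  have hdet : IsUnit W.det := isUnit_iff_ne_zero.2 hw.det_ne_zero
  refine ⟨⟨W⁻¹ᵀ * K * W⁻¹, ?_⟩, fun r s => ?_⟩
  · change (W⁻¹ᵀ * K * W⁻¹)ᵀ = _
    rw [Matrix.transpose_mul, Matrix.transpose_mul, Matrix.transpose_transpose, hK.eq,
      Matrix.mul_assoc]
  · have h1 : ∀ r, w r = W *ᵥ Pi.single r 1 := fun r => by
      funext i
      simp [hW]
    have h2 : ∀ r, W⁻¹ *ᵥ w r = Pi.single r 1 := fun r => by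
      rw [h1, Matrix.mulVec_mulVec, Matrix.nonsing_inv_mul _ hdet, Matrix.one_mulVec]
    unfold bil
    simp only
    rw [← Matrix.mulVec_mulVec, h2, ← Matrix.mulVec_mulVec, Matrix.dotProduct_mulVec,
      Matrix.vecMul_transpose, h2]
    simp

/-- The differentials read off the diagonal and the cyclic off-diagonal of the Gram matrix of `H` in
the basis `w r`. These entries can be prescribed independently, because `r`, `r + 1` and `r + 2` are
distinct. -/
theorem exists_fderiv_detFun_eq (hn : 5 ≤ n) (hw : MinimalCirculantZeros A w)
    (hA : NonsingularBlocks A) (t : Fin n ⊕ Fin n → ℝ) :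
    ∃ H, ∀ i, fderiv ℝ (detFun i) A H = t i := by
  choose g hg hgH using fderiv_detFun_inl hn hw hA
  choose g' hg' hgH' using fderiv_detFun_inr hn hw hA
  let K : Matrix (Fin n) (Fin n) ℝ := Matrix.of fun r s =>
    if r = s then t (Sum.inl (cyc r 3)) / g r
    else if s = cyc r 1 then t (Sum.inr (cyc r 3)) / g' r
    else if r = cyc s 1 then t (Sum.inr (cyc s 3)) / g' s
    else 0
  have hne : ∀ r : Fin n, r ≠ cyc r 1 := fun r => by simp (disch := omega) [self_eq_cyc_iff]
  have hne2 : ∀ r : Fin n, r ≠ cyc (cyc r 1) 1 := fun r => by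
    rw [cyc_cyc]; simp (disch := omega) [self_eq_cyc_iff]
  have hK : K.IsSymm := by
    refine Matrix.IsSymm.ext fun r s => ?_
    simp only [K, Matrix.of_apply]
    by_cases h1 : r = s
    · subst h1; rfl
    rw [if_neg h1, if_neg (Ne.symm h1)]
    by_cases h2 : r = cyc s 1
    · subst h2
      rw [if_pos rfl, if_neg (hne2 s), if_pos rfl]
    · rw [if_neg h2, if_neg h2]
  obtain ⟨H, hH⟩ := hw.exists_bil_eq hK
  refine ⟨H, ?_⟩
  rintro (j | j)
  · obtain ⟨r, rfl⟩ := cyc_surjective 3 j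
    refine (hgH r H).trans ?_
    rw [hH]
    simp only [K, Matrix.of_apply, if_true]
    exact mul_div_cancel₀ _ (hg r)
  · obtain ⟨r, rfl⟩ := cyc_surjective 3 j
    refine (hgH' r H).trans ?_
    rw [hH]
    simp only [K, Matrix.of_apply, if_neg (hne r), if_true]
    exact mul_div_cancel₀ _ (hg' r)

theorem linearIndependent_fderiv_detFun (hn : 5 ≤ n) (hw : MinimalCirculantZeros A w)
    (hA : NonsingularBlocks A) :
    LinearIndependent ℝ (fun i : Fin n ⊕ Fin n => fderiv ℝ (detFun i) A) := by
  refine (Fintype.linearIndependent_iff (R := ℝ) (M := SymMat n →L[ℝ] ℝ)).2 fun c hc i => ?_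
  obtain ⟨H, hH⟩ := exists_fderiv_detFun_eq hn hw hA (Pi.single i 1)
  have h1 := congrArg (fun L : SymMat n →L[ℝ] ℝ => L H) hc
  simp only [sum_apply, smul_apply, hH, smul_eq_mul, zero_apply] at h1
  simpa [Pi.single_apply] using h1

end gradient

/-! ### Level sets of submersions -/

section submanifold

open Topology

/-- With `L` the derivative at `x` and `R` a right inverse of it, `Φ y = y + R (f y - L y)`
satisfies `L ∘ Φ = f` and has identity derivative at `x`. It is thus a local diffeomorphism taking
the zero set of `f` to the kernel of `L`. -/
theorem exists_flattening {E G : Type*} [NormedAddCommGroup E] [NormedSpace ℝ E]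
    [FiniteDimensional ℝ E] [NormedAddCommGroup G] [NormedSpace ℝ G] [FiniteDimensional ℝ G]
    {f : E → G} (hf : ContDiff ℝ ∞ f) {U : Set E} (hU : IsOpen U) {x : E} (hx : x ∈ U)
    (hsurj : Function.Surjective (fderiv ℝ f x)) :
    ∃ (φ : OpenPartialHomeomorph E E) (F : Submodule ℝ E),
      x ∈ φ.source ∧ φ.source ⊆ U ∧ ContDiffOn ℝ ∞ φ φ.source ∧
      ContDiffOn ℝ ∞ φ.symm φ.target ∧ Module.finrank ℝ (E ⧸ F) = Module.finrank ℝ G ∧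
      ∀ y ∈ φ.source, f y = 0 ↔ φ y ∈ F := by
  have : CompleteSpace E := FiniteDimensional.complete ℝ E
  set L : E →L[ℝ] G := fderiv ℝ f x with hL
  obtain ⟨R', hR'⟩ := L.toLinearMap.exists_rightInverse_of_surjective
    (LinearMap.range_eq_top.2 hsurj)
  set R : G →L[ℝ] E := LinearMap.toContinuousLinearMap R' with hR
  have hLR : ∀ g, L (R g) = g := fun g => LinearMap.congr_fun hR' g
  let Φ : E → E := fun y => y + R (f y - L y)
  have hΦ : ContDiff ℝ ∞ Φ :=
    contDiff_id.add (R.contDiff.comp (hf.sub L.contDiff))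
  have hLΦ : ∀ y, L (Φ y) = f y := fun y => by
    simp only [Φ, map_add, hLR]
    abel
  have hf' : HasFDerivAt f L x := (hf.differentiable (by simp) x).hasFDerivAt
  have hΦ' : HasFDerivAt Φ ((ContinuousLinearEquiv.refl ℝ E : E ≃L[ℝ] E) : E →L[ℝ] E) x := by
    have h1 := (hasFDerivAt_id x).add
      (R.hasFDerivAt.comp x (hf'.sub (L.hasFDerivAt (x := x))))
    rw [sub_self, ContinuousLinearMap.comp_zero, add_zero] at h1
    exact h1
  let ψ := hΦ.contDiffAt.toOpenPartialHomeomorph Φ hΦ' (by simp)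
  have hψx : x ∈ ψ.source := hΦ.contDiffAt.mem_toOpenPartialHomeomorph_source hΦ' (by simp)
  have hopen : IsOpen {y | fderiv ℝ Φ y ∈ Set.range ((↑) : (E ≃L[ℝ] E) → E →L[ℝ] E)} :=
    (ContinuousLinearEquiv.isOpen (𝕜 := ℝ) (E := E) (F := E)).preimage
      (hΦ.continuous_fderiv (by simp))
  -- Restricting to points with invertible derivative makes the inverse chart smooth on its whole
  -- target, not only at the image of `x`.
  set V := U ∩ {y | fderiv ℝ Φ y ∈ Set.range ((↑) : (E ≃L[ℝ] E) → E →L[ℝ] E)} with hV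
  have hVo : IsOpen V := hU.inter hopen
  let φ := ψ.restrOpen V hVo
  have hφs : φ.source = ψ.source ∩ V := rfl
  have hφc : (φ : E → E) = Φ := rfl
  refine ⟨φ, L.toLinearMap.ker, ⟨hψx, hx, ?_⟩, fun y hy => hy.2.1, ?_, ?_, ?_, ?_⟩
  · exact ⟨_, hΦ'.fderiv.symm⟩
  · exact hΦ.contDiffOn
  · intro z hz
    have hz' : φ.symm z ∈ φ.source := φ.map_target hz
    obtain ⟨e, he⟩ := hz'.2.2
    refine (φ.contDiffAt_symm (f₀' := e) hz ?_ ?_).contDiffWithinAt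
    · rw [he]
      exact (hΦ.differentiable (by simp) _).hasFDerivAt
    · exact hΦ.contDiffAt
  · exact (L.toLinearMap.quotKerEquivOfSurjective hsurj).finrank_eq
  · intro y _
    rw [LinearMap.mem_ker]
    change _ ↔ L (Φ y) = 0
    rw [hLΦ]

variable {n : ℕ}

theorem isSmoothSubmanifold_detFun {U : Set (SymMat n)} (hU : IsOpen U)
    (h : ∀ A ∈ U, (∀ i, detFun i A = 0) →
      ∀ t : Fin n ⊕ Fin n → ℝ, ∃ H, ∀ i, fderiv ℝ (detFun i) A H = t i) :
    IsSmoothSubmanifoldOfCodim {A | A ∈ U ∧ ∀ i : Fin n ⊕ Fin n, detFun i A = 0} (2 * n) := by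
  rintro A ⟨hAU, hA⟩
  have hf : ContDiff ℝ ∞ fun (X : SymMat n) (i : Fin n ⊕ Fin n) => detFun i X :=
    contDiff_pi.2 contDiff_detFun
  have hfd : ∀ H i, fderiv ℝ (fun (X : SymMat n) (i : Fin n ⊕ Fin n) => detFun i X) A H i
      = fderiv ℝ (detFun i) A H := by
    intro H i
    have h1 := hasFDerivAt_pi.2 fun i : Fin n ⊕ Fin n =>
      ((contDiff_detFun i).differentiable (by simp) A).hasFDerivAt
    exact congrArg (fun L : SymMat n →L[ℝ] (Fin n ⊕ Fin n → ℝ) => L H i) h1.fderiv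
  obtain ⟨φ, F, h1, h2, h3, h4, h5, h6⟩ := exists_flattening hf hU hAU (by
    intro t
    obtain ⟨H, hH⟩ := h A hAU hA t
    exact ⟨H, funext fun i => (hfd H i).trans (hH i)⟩)
  refine ⟨φ, F, h1, h3, h4, ?_, fun y hy => ?_⟩
  · rw [h5, Module.finrank_fintype_fun_eq_card, Fintype.card_sum, Fintype.card_fin]
    ring
  · rw [← h6 y hy]
    exact ⟨fun h => funext h.2, fun h => ⟨h2 hy, congrFun h⟩⟩

/-- The determinants as polynomials in the matrix entries. -/
noncomputable def detPoly : Fin n ⊕ Fin n → MvPolynomial (Fin n × Fin n) ℝ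
  | Sum.inl j => (Matrix.of fun a b => MvPolynomial.X (idxI' j a, idxI' j b)).det
  | Sum.inr j => (Matrix.of fun a b => MvPolynomial.X (idxI' j a, idxI' (cyc j 1) b)).det

theorem eval_detPoly (i : Fin n ⊕ Fin n) (X : SymMat n) :
    MvPolynomial.eval (fun ab => X.1 ab.1 ab.2) (detPoly i) = detFun i X := by
  rcases i with j | j <;>
  · simp only [detPoly, detFun]
    rw [RingHom.map_det]
    congr 1
    ext a b
    simp

end submanifold

theorem mainTheorem4 (n : ℕ) (hn : 5 ≤ n) (A₀ : SymMat n)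
    (hA₀ : HasNonMinimalCirculantZeroSupport A₀) :
    ∃ U : Set (SymMat n), IsOpen U ∧ A₀ ∈ U ∧
      (∀ A ∈ U, CirculantRankCondition A →
        IsExceptional A ∧ IsExtremal A ∧ HasNonMinimalCirculantZeroSupport A) ∧
      CirculantRankCondition A₀ ∧
      IsAlgebraicSubmanifoldOfCodim U {A | A ∈ U ∧ CirculantRankCondition A} (2 * n) ∧
      (∀ A ∈ U, CirculantRankCondition A ↔ ∀ i : Fin n ⊕ Fin n, detFun i A = 0) ∧
      (∀ A ∈ U, CirculantRankCondition A →
        LinearIndependent ℝ (fun i : Fin n ⊕ Fin n => fderiv ℝ (detFun i) A)) := by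
  obtain ⟨u, v, hu, hv, hne⟩ := exists_circulantZeros hn hA₀
  obtain ⟨w, hw⟩ := exists_minimalCirculantZeros hn hA₀.1 hu hv hne
  obtain ⟨U, hUs, hUo, hAU⟩ :=
    eventually_nhds_iff.1 (eventually_minimalCirculantZeros hn hA₀.1 hu hw)
  have hiff : ∀ A ∈ U, CirculantRankCondition A ↔ ∀ i : Fin n ⊕ Fin n, detFun i A = 0 := by
    intro A hA
    refine ⟨fun h => h.detFun_eq_zero hn, fun h => ?_⟩
    obtain ⟨w', hw', -⟩ := (hUs A hA).2 h
    exact hw'.circulantRankCondition hn (hUs A hA).1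
  have hset : {A | A ∈ U ∧ CirculantRankCondition A}
      = {A | A ∈ U ∧ ∀ i : Fin n ⊕ Fin n, detFun i A = 0} := by
    ext A
    exact and_congr_right fun hA => hiff A hA
  refine ⟨U, hUo, hAU, fun A hA hrk => ?_,
    hw.circulantRankCondition hn (nonsingularBlocks_of_exceptional hn hA₀.1 hu hw),
    ⟨?_, n + n, fun i => detPoly (finSumFinEquiv.symm i), ?_⟩, hiff, fun A hA hrk => ?_⟩
  · obtain ⟨w', hw', hcop⟩ := (hUs A hA).2 ((hiff A hA).1 hrk)
    exact ⟨hw'.isExceptional hn hcop, hw'.isExtremal hn hcop (hUs A hA).1,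
      hw'.hasNonMinimalCirculantZeroSupport hn hcop⟩
  · rw [hset]
    refine isSmoothSubmanifold_detFun hUo fun A hA hdet => ?_
    obtain ⟨w', hw', -⟩ := (hUs A hA).2 hdet
    exact exists_fderiv_detFun_eq hn hw' (hUs A hA).1
  · rw [hset]
    ext A
    refine and_congr_right fun _ => ?_
    simp only [eval_detPoly]
    exact ⟨fun h i => h _, fun h i => by simpa using h (finSumFinEquiv i)⟩
  · obtain ⟨w', hw', -⟩ := (hUs A hA).2 ((hiff A hA).1 hrk)
    exact linearIndependent_fderiv_detFun hn hw' (hUs A hA).1
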